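/- **Conventions.** A *graphon* on a probability space $(\Omega,\mathcal A,\pi)$ is a symmetric measurable function $W:\Omega\times\Omega\to[0,1]$. For graphons $U,V$ on $[0,1]$ (with the uniform measure) put $$\delta_1(U,V)=\inf_\phi\int_{[0,1]^2}|U-V^\phi|\,dx\,dy,\qquad \delta_\square(U,V)=\inf_\phi\ \sup_{A,B\subseteq[0,1]}\Bigl|\int_{A\times B}(U-V^\phi)\,dx\,dy\Bigr|,$$ where $A,B$ are measurable, $\phi$ ranges over the invertible maps $[0,1]\to[0,1]$ that are measure preserving together with their inverse, and $V^\phi(x,y)=V(\phi(x),\phi(y))$. A graphon $\widetilde W$ on $[0,1]$ *represents* a graphon $W$ on $(\Omega,\pi)$ if for some coupling $\mu$ of $\pi$ and the uniform measure on $[0,1]$ we have $W(x,x')=\widetilde W(y,y')$ for $\mu\otimes\mu$-almost every pair $((x,y),(x',y'))$. For a finite (weighted) graph $G$ on $k$ nodes, $W_G$ is the step function on $[0,1]^2$ that is equal to the weight of $ij$ ($1$ for an edge and $0$ for a non-edge, if $G$ is a simple graph) on the product of the $i$-th and the $j$-th of the $k$ equal intervals into which $[0,1]$ is split; the nodes may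 be labelled in any way. For a finite set $S\subseteq\Omega$, $\mathbb H(S,W)$ is the weighted graph on $S$ without loops in which distinct $s,t$ are joined by an edge of weight $W(s,t)$, and $\mathbb G(S,W)$ is the random simple graph on $S$ in which distinct $s,t$ are joined with probability $W(s,t)$, independently for all pairs. Finite sets $S_n\subseteq\Omega$ with $|S_n|\to\infty$ are *well distributed* in a metric space $(\Omega,d)$ with a Borel probability measure $\pi$ if for every $\varepsilon>0$ there is a partition $\{P_1,\dots,P_m\}$ of $\Omega$ into finitely many Borel sets of diameter at most $\varepsilon$ such that $|S_n\cap P_j|/|S_n|\to\pi(P_j)$ as $n\to\infty$ for every $j$. **Lemma 2.3.** Let $(\Omega,d)$ be a metric space with an atom-free Borel probability measure $\pi$, let $W:\Omega\times\Omega\to[0,1]$ be a symmetric measurable function that is continuous at $\pi\otimes\pi$-almost every point, and let $(S_n)$ be well distributed in $(\Omega,d,\pi)$. Then $W$ is represented by a graphon on $[0,1]$, and for every graphon $\widetilde W$ on $[0,1]$ that represents $W$ the following hold. (a) $\delta_1(W_{\mathbb H(S_n,W)},\widetilde W)\to0$. If moreover $\sum_n e^{-c|S_n|^2}<\infty$ for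 every $c>0$ (for example, if $|S_n|\ge n$ for all $n$), then, whatever the joint distribution of the random graphs $\mathbb G(S_n,W)$ on a common probability space, $\delta_\square(W_{\mathbb G(S_n,W)},\widetilde W)\to0$ with probability $1$. (b) If $W$ is $0$-$1$ valued, then $\delta_1(W_{\mathbb G(S_n,W)},\widetilde W)\to0$ with probability $1$ (in this case $\mathbb G(S_n,W)$ is almost surely a fixed graph), with no condition on the growth of $|S_n|$. -/

import Mathlib

open MeasureTheory ProbabilityTheory Filter Topology unitInterval

noncomputable section

namespace GraphLimits

/-! ### Functions on the unit square: norms and distances -/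

/-- A symmetric measurable function of two variables with values in `[0,1]`. -/
structure IsGraphon {Ω : Type*} [MeasurableSpace Ω] (W : Ω → Ω → ℝ) : Prop where
  measurable : Measurable (Function.uncurry W)
  symm : ∀ x y, W x y = W y x
  nonneg : ∀ x y, 0 ≤ W x y
  le_one : ∀ x y, W x y ≤ 1

/-- The `L¹` norm of a function on `[0,1]²`. -/
def l1Norm (U : I → I → ℝ) : ℝ :=
  ∫ p : I × I, |U p.1 p.2|

/-- The cut norm of a (bounded measurable) function on `[0,1]²`: the supremum over measurable
`S, T ⊆ [0,1]` of the absolute value of the integral over `S × T`. -/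
def cutNorm (U : I → I → ℝ) : ℝ :=
  ⨆ p : {S : Set I // MeasurableSet S} × {T : Set I // MeasurableSet T},
    |∫ z in (p.1 : Set I) ×ˢ (p.2 : Set I), U z.1 z.2|

/-- The invertible maps `[0,1] → [0,1]` which, together with their inverse, are
measure preserving. -/
def Rearrangement : Type :=
  {φ : I ≃ᵐ I // MeasurePreserving φ volume volume ∧ MeasurePreserving φ.symm volume volume}

/-- The edit distance `δ₁(U, V) = inf_φ ‖U - V^φ‖₁`, where `V^φ(x, y) = V(φ(x), φ(y))`. -/
def editDist (U V : I → I → ℝ) : ℝ :=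
  ⨅ φ : Rearrangement, l1Norm fun x y => U x y - V (φ.1 x) (φ.1 y)

/-- The cut distance `δ_□(U, V) = inf_φ ‖U - V^φ‖_□`. -/
def cutDist (U V : I → I → ℝ) : ℝ :=
  ⨅ φ : Rearrangement, cutNorm fun x y => U x y - V (φ.1 x) (φ.1 y)

/-- `V` on `[0,1]²` represents the function `W` on `Ω × Ω`, where `Ω` carries the probability
measure `π`: on some coupling of `π` with the uniform measure on `[0,1]`, the pullbacks of `W`
and of `V` along the two (measure preserving) projections agree almost everywhere. -/
def Represents {Ω : Type*} [MeasurableSpace Ω] (π : Measure Ω) (W : Ω → Ω → ℝ)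
    (V : I → I → ℝ) : Prop :=
  ∃ μ : Measure (Ω × I), MeasurePreserving Prod.fst μ π ∧ MeasurePreserving Prod.snd μ volume ∧
    ∀ᵐ p ∂(μ.prod μ), W p.1.1 p.2.1 = V p.1.2 p.2.2

/-! ### Step functions of graphs -/

/-- The `i`-th of the `n` equal intervals `[i/n, (i+1)/n)` into which `[0,1]` is split
(the last one contains the point `1`). -/
def stepInterval (n : ℕ) (i : Fin n) : Set I :=
  {x | (i : ℝ) ≤ n * (x : ℝ) ∧ (n * (x : ℝ) < (i : ℝ) + 1 ∨ (i : ℕ) + 1 = n)}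

/-- The function on `[0,1]²` attached to a weighted graph with node set `V` and edge weights `A`,
the nodes being listed by `e`: it takes the value `A (e i) (e j)` on the product of the `i`-th
and the `j`-th interval. -/
def graphFun {V : Type*} {n : ℕ} (e : Fin n ≃ V) (A : V → V → ℝ) (x y : I) : ℝ :=
  ∑ i : Fin n, ∑ j : Fin n,
    (stepInterval n i).indicator 1 x * (stepInterval n j).indicator 1 y * A (e i) (e j)

open Classical in
/-- The adjacency matrix of a simple graph. -/
def adjWeight {V : Type*} (G : SimpleGraph V) (s t : V) : ℝ :=
  if G.Adj s t then 1 else 0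

open Classical in
/-- The edge weights of `ℍ(S, W)`: distinct `s, t ∈ S` are joined by an edge of weight `W s t`,
and there are no loops. -/
def weightedGraph {Ω : Type*} (S : Finset Ω) (W : Ω → Ω → ℝ) (s t : S) : ℝ :=
  if s = t then 0 else W s t

/-- `G` is a random graph with the distribution of `𝔾(S, W)`: its node set is `S`, distinct
`s, t ∈ S` are adjacent with probability `W s t`, and this independently for all unordered pairs
of distinct nodes. -/
structure IsWRandomGraph {Ω X : Type*} [MeasurableSpace X] (P : Measure X) (S : Finset Ω)
    (W : Ω → Ω → ℝ) (G : X → SimpleGraph S) : Prop where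
  measurableSet_adj : ∀ s t : S, MeasurableSet {x | (G x).Adj s t}
  prob_adj : ∀ s t : S, s ≠ t → P {x | (G x).Adj s t} = ENNReal.ofReal (W s t)
  indep : iIndepSet
    (fun e : {e : Sym2 S // ¬ e.IsDiag} => {x | (e : Sym2 S) ∈ (G x).edgeSet}) P

/-! ### Well distributed sequences of finite sets -/

/-- The sequence `S n` of finite sets is well distributed in the set `A`. -/
def WellDistributedIn {Ω : Type*} [MeasurableSpace Ω] (π : Measure Ω) (S : ℕ → Finset Ω)
    (A : Set Ω) : Prop :=
  Tendsto (fun n => (((S n : Set Ω) ∩ A).ncard : ℝ) / ((S n).card : ℝ)) atTop (𝓝 (π.real A))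

/-- The sequence `S n` of finite sets with `|S n| → ∞` is well distributed in the metric
probability space `Ω`: for every `ε > 0` there is a partition of `Ω` into finitely many
measurable sets of diameter at most `ε`, in each of which `S n` is well distributed. -/
def WellDistributed {Ω : Type*} [MetricSpace Ω] [MeasurableSpace Ω] (π : Measure Ω)
    (S : ℕ → Finset Ω) : Prop :=
  Tendsto (fun n => (S n).card) atTop atTop ∧
    ∀ ε : ℝ, 0 < ε → ∃ (m : ℕ) (Q : Fin m → Set Ω),
      (∀ j, MeasurableSet (Q j)) ∧ Pairwise (fun j k => Disjoint (Q j) (Q k)) ∧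
      (⋃ j, Q j) = Set.univ ∧ (∀ j, ∀ x ∈ Q j, ∀ y ∈ Q j, dist x y ≤ ε) ∧
      ∀ j, WellDistributedIn π S (Q j)

end GraphLimits

end

namespace GraphLimits

/-! Representation. The partitions make `Ω` second countable, so its σ-algebra is pulled back from
the Cantor space and `W` factors through it. The image of `π` there is also the law of a function
`Q` of a uniform variable, and composing with `Q` gives a representing graphon.

Weighted graphs. The nodes may form a null set, so values of `W` at them cannot be controlled by an
`L¹` approximation. Continuity almost everywhere supplies a finite partition on which `W` is within
`o` of a step function `a` at every point, where `o` is constant on products of classes and has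
small integral. Well-distributedness carries this small integral over to the nodes
(`exists_oscillation_lt`). The representing graphon `V` is `L¹`-close to a step function `v` on `L`
intervals. Under the coupling `W = V`, so `a` and `v` are close in mean; this mean is a polynomial
in the masses of the cells (class, interval). The nodes are therefore labelled so that the cell
frequencies approach these masses (`eventually_exists_labelling`), and continuity of the polynomial
does the rest. Any other labelling differs by a permutation of blocks, which is a rearrangement of
`[0,1]`.

Random graphs. The cut norm of a step function is bounded by a maximum over `4 ^ k` pairs of node
sets. Each pair has a sub-Gaussian deviation of failure probability `exp (-c k²)`, so a union bound
and Borel–Cantelli apply (`IsWRandomGraph.measure_exists_le`). For `0`-`1` valued `W` the random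
graph almost surely equals the weighted one. -/

/-! ### Representation by a graphon on the unit interval -/

/-- A countably generated, point-separating σ-algebra is pulled back from the Cantor space. -/
theorem exists_comap_natBool_eq (Ω : Type*) [m : MeasurableSpace Ω]
    [MeasurableSpace.CountablyGenerated Ω] [MeasurableSpace.SeparatesPoints Ω] :
    ∃ f : Ω → ℕ → Bool, m = MeasurableSpace.comap f inferInstance := by
  obtain ⟨s, ⟨f⟩⟩ := MeasurableSpace.measurableEquiv_nat_bool_of_countablyGenerated Ω
  refine ⟨fun x => (f x : ℕ → Bool), ?_⟩
  refine f.measurableEmbedding.comap_eq.symm.trans ?_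
  change MeasurableSpace.comap f (MeasurableSpace.comap Subtype.val inferInstance) = _
  rw [MeasurableSpace.comap_comp]
  rfl

theorem exists_represents {Ω : Type*} [m : MeasurableSpace Ω]
    [MeasurableSpace.CountablyGenerated Ω] [MeasurableSpace.SeparatesPoints Ω]
    (π : Measure Ω) [IsProbabilityMeasure π] {W : Ω → Ω → ℝ} (hW : IsGraphon W) :
    ∃ V : I → I → ℝ, IsGraphon V ∧ Represents π W V := by
  obtain ⟨f, hf⟩ := exists_comap_natBool_eq Ω
  have hfm : Measurable f := by rw [hf]; exact comap_measurable f
  have hmeas : @Measurable _ _ (MeasurableSpace.comap (Prod.map f f) inferInstance) _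
      (Function.uncurry W) := by
    have h := MeasurableSpace.comap_prodMap (mα := (inferInstance : MeasurableSpace (ℕ → Bool)))
      (mβ := (inferInstance : MeasurableSpace (ℕ → Bool))) f f
    rw [← hf] at h
    rw [show (MeasurableSpace.comap (Prod.map f f) inferInstance : MeasurableSpace (Ω × Ω)) = _
      from h]
    exact hW.measurable
  obtain ⟨W', hW'm, hW'⟩ := hmeas.exists_eq_measurable_comp
  have : IsProbabilityMeasure (π.map f) := Measure.isProbabilityMeasure_map hfm.aemeasurable
  obtain ⟨Q, hQm, hQ⟩ := (π.map f).exists_measurable_map_eq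
  have hWf : ∀ x y, W x y = W' (f x, f y) := fun x y => congrFun hW' (x, y)
  -- `W'` is symmetric and `[0,1]`-valued only on the range of `f`, hence the symmetrization and the
  -- truncation.
  let V : I → I → ℝ := fun y y' => max 0 (min 1 ((W' (Q y, Q y') + W' (Q y', Q y)) / 2))
  refine ⟨V, ⟨?_, ?_, ?_, ?_⟩, ?_⟩
  · change Measurable fun p : I × I => max 0 (min 1 ((W' (Q p.1, Q p.2) + W' (Q p.2, Q p.1)) / 2))
    fun_prop
  · intro x y
    simp only [V, add_comm]
  · intro x y
    exact le_max_left _ _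
  · intro x y
    exact max_le zero_le_one (min_le_left _ _)
  -- The coupling: given `x`, the second coordinate is a uniform variable conditioned on `Q = f x`.
  -- Conditioning on the side of `I` needs no regularity of `Ω`.
  let κ := condDistrib (id : I → I) Q volume
  let μ : Measure (Ω × I) := π ⊗ₘ (κ.comap f hfm)
  have hμmap : μ.map (Prod.map f id) = (volume : Measure I).map (fun y => (Q y, y)) := by
    have h := compProd_map_condDistrib (mβ := inferInstance) (X := Q) (Y := (id : I → I))
      (μ := volume) measurable_id.aemeasurable
    rw [hQ] at h
    refine Eq.trans ?_ h
    ext s hs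
    rw [Measure.map_apply (hfm.prodMap measurable_id) hs,
      Measure.compProd_apply (hfm.prodMap measurable_id hs), Measure.compProd_apply hs,
      lintegral_map (Kernel.measurable_kernel_prodMk_left hs) hfm]
    rfl
  have hfst : MeasurePreserving Prod.fst μ π :=
    ⟨measurable_fst, Measure.fst_compProd π _⟩
  have hsnd : MeasurePreserving Prod.snd μ (volume : Measure I) := by
    refine ⟨measurable_snd, ?_⟩
    have h := congrArg (fun ρ => Measure.map Prod.snd ρ) hμmap
    rw [Measure.map_map measurable_snd (hfm.prodMap measurable_id),
      Measure.map_map measurable_snd (hQm.prodMk measurable_id')] at h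
    have h2 : (Prod.snd ∘ fun y : I => (Q y, y)) = id := rfl
    rw [h2, Measure.map_id] at h
    exact h
  refine ⟨μ, hfst, hsnd, ?_⟩
  have hae : ∀ᵐ p ∂μ, f p.1 = Q p.2 := by
    have hset : MeasurableSet {z : (ℕ → Bool) × I | z.1 = Q z.2} :=
      measurableSet_eq_fun measurable_fst (hQm.comp measurable_snd)
    have h : ∀ᵐ z ∂(μ.map (Prod.map f id)), z.1 = Q z.2 := by
      rw [hμmap, ae_map_iff (hQm.prodMk measurable_id').aemeasurable hset]
      exact ae_of_all _ fun _ => rfl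
    rw [ae_map_iff (hfm.prodMap measurable_id).aemeasurable hset] at h
    exact h
  have h1 : ∀ᵐ p ∂(μ.prod μ), f p.1.1 = Q p.1.2 := Measure.quasiMeasurePreserving_fst.ae hae
  have h2 : ∀ᵐ p ∂(μ.prod μ), f p.2.1 = Q p.2.2 := Measure.quasiMeasurePreserving_snd.ae hae
  filter_upwards [h1, h2] with p hp1 hp2
  have e1 := hWf p.1.1 p.2.1
  have e2 := hWf p.2.1 p.1.1
  rw [hW.symm] at e2
  rw [hp1, hp2] at e1 e2
  have : W p.1.1 p.2.1 = (W' (Q p.1.2, Q p.2.2) + W' (Q p.2.2, Q p.1.2)) / 2 := by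
    rw [← e1, ← e2]; ring
  simp only [V]
  rw [← this, min_eq_right (hW.le_one _ _), max_eq_right (hW.nonneg _ _)]

/-! ### Blocks: the `k` equal intervals of `[0,1]` -/

/-- The index of the block, out of `k`, that contains `x`. -/
noncomputable def blockIdx (k : ℕ) [NeZero k] (x : I) : Fin k :=
  ⟨min ⌊(k : ℝ) * x⌋₊ (k - 1), by have := NeZero.pos k; omega⟩

section Blocks
variable {k : ℕ} [NeZero k]

/-- The minimum in `blockIdx` matters only at the endpoint `1`, where it agrees with the second
alternative in `stepInterval`. -/
theorem mem_stepInterval_iff (i : Fin k) (x : I) : x ∈ stepInterval k i ↔ blockIdx k x = i := by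
  have hk := NeZero.pos k
  have hk0 : (0 : ℝ) < k := by exact_mod_cast hk
  have hx0 : 0 ≤ (k : ℝ) * x := mul_nonneg hk0.le x.2.1
  have h1 : ((i : ℕ) : ℝ) ≤ k * (x : ℝ) ↔ (i : ℕ) ≤ ⌊(k : ℝ) * x⌋₊ := (Nat.le_floor_iff hx0).symm
  have h2 : (k : ℝ) * x < (i : ℕ) + 1 ↔ ⌊(k : ℝ) * x⌋₊ < (i : ℕ) + 1 := by
    rw [Nat.floor_lt hx0]; push_cast; rfl
  simp only [stepInterval, Set.mem_ofPred_eq, h1, h2, blockIdx, Fin.ext_iff]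
  have := i.2
  omega

theorem measurable_blockIdx : Measurable (blockIdx k) := by
  have h : Measurable fun x : I => min ⌊(k : ℝ) * x⌋₊ (k - 1) := by
    have : Measurable fun x : I => (k : ℝ) * x := by fun_prop
    exact (Nat.measurable_floor.comp this).min measurable_const
  refine measurable_to_countable' fun i => ?_
  have : blockIdx k ⁻¹' {i} = (fun x : I => min ⌊(k : ℝ) * x⌋₊ (k - 1)) ⁻¹' {(i : ℕ)} := by
    ext x; simp [blockIdx, Fin.ext_iff]
  rw [this]
  exact h (measurableSet_singleton _)

theorem blockIdx_le (x : I) : ((blockIdx k x : ℕ) : ℝ) ≤ k * x :=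
  ((mem_stepInterval_iff (blockIdx k x) x).2 rfl).1

theorem le_blockIdx_add_one (x : I) : (k : ℝ) * x ≤ (blockIdx k x : ℕ) + 1 := by
  rcases ((mem_stepInterval_iff (blockIdx k x) x).2 rfl).2 with h | h
  · exact h.le
  · have : ((blockIdx k x : ℕ) : ℝ) + 1 = k := by exact_mod_cast h
    rw [this]
    exact mul_le_of_le_one_right (Nat.cast_nonneg _) x.2.2

theorem lt_blockIdx_add_one {x : I} (hx : x ≠ 1) : (k : ℝ) * x < (blockIdx k x : ℕ) + 1 := by
  rcases ((mem_stepInterval_iff (blockIdx k x) x).2 rfl).2 with h | h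
  · exact h
  · have : ((blockIdx k x : ℕ) : ℝ) + 1 = k := by exact_mod_cast h
    rw [this]
    have hk0 : (0 : ℝ) < k := by exact_mod_cast NeZero.pos k
    have : (x : ℝ) < 1 := lt_of_le_of_ne x.2.2 fun h => hx (Subtype.ext h)
    nlinarith

theorem blockIdx_eq_of {x : I} {i : Fin k} (h1 : ((i : ℕ) : ℝ) ≤ k * x)
    (h2 : (k : ℝ) * x < (i : ℕ) + 1) : blockIdx k x = i :=
  (mem_stepInterval_iff i x).1 ⟨h1, Or.inl h2⟩

theorem volume_blockIdx_preimage (i : Fin k) :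
    (volume : Measure I) (blockIdx k ⁻¹' {i}) = ENNReal.ofReal (1 / k) := by
  have hk0 : (0 : ℝ) < k := by exact_mod_cast NeZero.pos k
  have hi : ((i : ℕ) : ℝ) + 1 ≤ k := by exact_mod_cast i.2
  have hi0 : (0 : ℝ) ≤ (i : ℕ) := Nat.cast_nonneg _
  let a : I := ⟨(i : ℕ) / k, by positivity, by rw [div_le_one hk0]; linarith⟩
  let b : I := ⟨((i : ℕ) + 1) / k, by positivity, by rw [div_le_one hk0]; linarith⟩
  have hab : (b : ℝ) - a = 1 / k := by simp only [a, b]; ring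
  apply le_antisymm
  · rw [← hab, ← unitInterval.volume_Icc]
    refine measure_mono fun x hx => ?_
    have hx' : blockIdx k x = i := hx
    have h1 := blockIdx_le (k := k) x
    have h2 := le_blockIdx_add_one (k := k) x
    rw [hx'] at h1 h2
    constructor
    · change ((i : ℕ) / k : ℝ) ≤ x
      rw [div_le_iff₀ hk0]; linarith
    · change (x : ℝ) ≤ ((i : ℕ) + 1) / k
      rw [le_div_iff₀ hk0]; linarith
  · rw [← hab, ← unitInterval.volume_Ico]
    refine measure_mono fun x hx => ?_
    have h1 : ((i : ℕ) / k : ℝ) ≤ x := hx.1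
    have h2 : (x : ℝ) < ((i : ℕ) + 1) / k := hx.2
    rw [div_le_iff₀ hk0] at h1
    rw [lt_div_iff₀ hk0] at h2
    exact blockIdx_eq_of (by linarith) (by linarith)

theorem volume_real_blockIdx_preimage (i : Fin k) :
    (volume : Measure I).real (blockIdx k ⁻¹' {i}) = 1 / k := by
  rw [measureReal_def, volume_blockIdx_preimage, ENNReal.toReal_ofReal (by positivity)]

theorem graphFun_apply {V : Type*} (e : Fin k ≃ V) (A : V → V → ℝ) (x y : I) :
    graphFun e A x y = A (e (blockIdx k x)) (e (blockIdx k y)) := by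
  have h : ∀ (i : Fin k) (x : I), (stepInterval k i).indicator (1 : I → ℝ) x
      = if blockIdx k x = i then 1 else 0 := by
    intro i x
    by_cases hx : blockIdx k x = i
    · rw [if_pos hx, Set.indicator_of_mem ((mem_stepInterval_iff i x).2 hx), Pi.one_apply]
    · rw [if_neg hx, Set.indicator_of_notMem fun h => hx ((mem_stepInterval_iff i x).1 h)]
  simp [graphFun, h]

/-! ### Permuting blocks -/

/-- The map of `[0,1)` that translates each block so as to permute the blocks by `ρ`; it fixes
the endpoint `1`. -/
noncomputable def blockShift (ρ : Equiv.Perm (Fin k)) (x : I) : I :=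
  if h : x = 1 then 1 else
    ⟨x + ((ρ (blockIdx k x) : ℕ) - (blockIdx k x : ℕ) : ℝ) / k, by
      have hk0 : (0 : ℝ) < k := by exact_mod_cast NeZero.pos k
      have h1 := blockIdx_le (k := k) x
      have h2 := lt_blockIdx_add_one (k := k) h
      have hi : ((ρ (blockIdx k x) : ℕ) : ℝ) + 1 ≤ k := by exact_mod_cast (ρ (blockIdx k x)).2
      have hi0 : (0 : ℝ) ≤ (ρ (blockIdx k x) : ℕ) := Nat.cast_nonneg _
      have e : (x : ℝ) + ((ρ (blockIdx k x) : ℕ) - (blockIdx k x : ℕ) : ℝ) / k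
        = (k * x + ((ρ (blockIdx k x) : ℕ) - (blockIdx k x : ℕ) : ℝ)) / k := by field_simp
      rw [e]
      constructor
      · apply div_nonneg _ hk0.le; linarith
      · rw [div_le_one hk0]; linarith⟩

theorem mul_coe_blockShift (ρ : Equiv.Perm (Fin k)) {x : I} (hx : x ≠ 1) :
    (k : ℝ) * blockShift ρ x = k * x + ((ρ (blockIdx k x) : ℕ) - (blockIdx k x : ℕ) : ℝ) := by
  have hk0 : (0 : ℝ) < k := by exact_mod_cast NeZero.pos k
  simp only [blockShift, hx, dite_false]
  field_simp

theorem blockShift_one (ρ : Equiv.Perm (Fin k)) : blockShift ρ 1 = 1 := by simp [blockShift]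

theorem blockIdx_blockShift (ρ : Equiv.Perm (Fin k)) {x : I} (hx : x ≠ 1) :
    blockIdx k (blockShift ρ x) = ρ (blockIdx k x) := by
  have h1 := blockIdx_le (k := k) x
  have h2 := lt_blockIdx_add_one (k := k) hx
  apply blockIdx_eq_of <;> rw [mul_coe_blockShift ρ hx] <;> linarith

theorem blockShift_ne_one (ρ : Equiv.Perm (Fin k)) {x : I} (hx : x ≠ 1) : blockShift ρ x ≠ 1 := by
  intro h
  have h1 := mul_coe_blockShift ρ hx
  have h2 := lt_blockIdx_add_one (k := k) hx
  have hi : ((ρ (blockIdx k x) : ℕ) : ℝ) + 1 ≤ k := by exact_mod_cast (ρ (blockIdx k x)).2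
  rw [h] at h1
  simp only [Set.Icc.coe_one, mul_one] at h1
  linarith

/-- Shifts compose like permutations, so `ρ.symm` supplies the inverse of a shift. -/
theorem blockShift_blockShift (ρ τ : Equiv.Perm (Fin k)) (x : I) :
    blockShift ρ (blockShift τ x) = blockShift (τ.trans ρ) x := by
  by_cases hx : x = 1
  · simp [hx, blockShift_one]
  have hk0 : (0 : ℝ) < k := by exact_mod_cast NeZero.pos k
  apply Subtype.ext
  apply mul_left_cancel₀ hk0.ne'
  rw [mul_coe_blockShift _ (blockShift_ne_one τ hx), mul_coe_blockShift _ hx,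
    mul_coe_blockShift _ hx, blockIdx_blockShift _ hx, Equiv.trans_apply]
  ring

theorem blockShift_refl (x : I) : blockShift (Equiv.refl (Fin k)) x = x := by
  by_cases hx : x = 1
  · simp [hx, blockShift_one]
  · simp [blockShift, hx]

theorem measurable_blockShift (ρ : Equiv.Perm (Fin k)) : Measurable (blockShift ρ) := by
  have hm : Measurable fun x : I =>
      if x = 1 then (1 : ℝ) else
        x + ((ρ (blockIdx k x) : ℕ) - (blockIdx k x : ℕ) : ℝ) / k := by
    refine Measurable.ite (measurableSet_singleton _) measurable_const ?_
    have : Measurable fun i : Fin k => ((ρ i : ℕ) - (i : ℕ) : ℝ) / k := measurable_from_top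
    exact measurable_subtype_coe.add (this.comp measurable_blockIdx)
  have h2 : (fun x : I => ((blockShift ρ x : I) : ℝ)) = fun x : I =>
      if x = 1 then (1 : ℝ) else
        x + ((ρ (blockIdx k x) : ℕ) - (blockIdx k x : ℕ) : ℝ) / k := by
    funext x
    by_cases hx : x = 1
    · simp [hx, blockShift_one]
    · simp [blockShift, hx]
  rw [← h2] at hm
  exact hm.subtype_mk (h := fun x => (blockShift ρ x).2)

/-- On a single block the shift is a translation of the line, and the exceptional point `1` is null.
-/
theorem volume_blockShift_preimage_inter (ρ : Equiv.Perm (Fin k)) (s : Set I) (i : Fin k) :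
    (volume : Measure I) (blockShift ρ ⁻¹' s ∩ blockIdx k ⁻¹' {i})
      = volume (s ∩ blockIdx k ⁻¹' {ρ i}) := by
  have hk0 : (0 : ℝ) < k := by exact_mod_cast NeZero.pos k
  have hnull : (volume : Measure I) {1} = 0 := measure_singleton _
  rw [← measure_sdiff_null hnull, ← measure_sdiff_null (s := s ∩ _) hnull,
    unitInterval.volume_apply, unitInterval.volume_apply,
    ← measure_preimage_add_right volume (((i : ℕ) - (ρ i : ℕ) : ℝ) / k)]
  congr 1
  ext y
  simp only [Set.mem_image, Set.mem_preimage]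
  constructor
  · rintro ⟨x, ⟨⟨hxs, hxi⟩, hx1⟩, hxy⟩
    have hx1' : x ≠ 1 := hx1
    have hxi' : blockIdx k x = i := hxi
    refine ⟨blockShift ρ x, ⟨⟨hxs, ?_⟩, blockShift_ne_one ρ hx1'⟩, ?_⟩
    · change blockIdx k (blockShift ρ x) = ρ i
      rw [blockIdx_blockShift ρ hx1', hxi']
    · simp only [blockShift, hx1', hxi', dite_false, hxy]
      ring
  · rintro ⟨z, ⟨⟨hzs, hzi⟩, hz1⟩, hzy⟩
    have hz1' : z ≠ 1 := hz1
    have hzi' : blockIdx k z = ρ i := hzi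
    refine ⟨blockShift ρ.symm z, ⟨⟨?_, ?_⟩, blockShift_ne_one _ hz1'⟩, ?_⟩
    · change blockShift ρ (blockShift ρ.symm z) ∈ s
      rw [blockShift_blockShift, Equiv.symm_trans_self, blockShift_refl]
      exact hzs
    · change blockIdx k (blockShift ρ.symm z) = i
      rw [blockIdx_blockShift _ hz1', hzi', Equiv.symm_apply_apply]
    · simp only [blockShift, hz1', hzi', dite_false, Equiv.symm_apply_apply, hzy]

theorem volume_eq_sum_blocks (s : Set I) :
    (volume : Measure I) s = ∑ i : Fin k, volume (s ∩ blockIdx k ⁻¹' {i}) := by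
  have h := sum_measure_preimage_singleton (μ := (volume : Measure I).restrict s)
    (Finset.univ : Finset (Fin k)) (f := blockIdx k)
    fun i _ => measurable_blockIdx (measurableSet_singleton i)
  simp only [Finset.coe_univ, Set.preimage_univ, Measure.restrict_apply_univ] at h
  rw [← h]
  refine Finset.sum_congr rfl fun i _ => ?_
  rw [Measure.restrict_apply (measurable_blockIdx (measurableSet_singleton i)), Set.inter_comm]

theorem measurePreserving_blockShift (ρ : Equiv.Perm (Fin k)) :
    MeasurePreserving (blockShift ρ) volume volume := by
  refine ⟨measurable_blockShift ρ, ?_⟩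
  ext s hs
  rw [Measure.map_apply (measurable_blockShift ρ) hs, volume_eq_sum_blocks (k := k),
    volume_eq_sum_blocks (k := k) s,
    ← Equiv.sum_comp ρ fun i => volume (s ∩ blockIdx k ⁻¹' {i})]
  exact Finset.sum_congr rfl fun i _ => volume_blockShift_preimage_inter ρ s i

/-- The rearrangement of `[0,1]` that permutes the blocks by `ρ`. -/
noncomputable def blockRearrangement (ρ : Equiv.Perm (Fin k)) : Rearrangement :=
  ⟨{ toFun := blockShift ρ
     invFun := blockShift ρ.symm
     left_inv := fun x => by
      rw [blockShift_blockShift, Equiv.self_trans_symm, blockShift_refl]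
     right_inv := fun x => by
      rw [blockShift_blockShift, Equiv.symm_trans_self, blockShift_refl]
     measurable_toFun := measurable_blockShift ρ
     measurable_invFun := measurable_blockShift ρ.symm },
    measurePreserving_blockShift ρ, measurePreserving_blockShift ρ.symm⟩

/-- Relabelling the nodes of a graph amounts to a rearrangement of `[0,1]`. -/
theorem exists_rearrangement_l1Norm_eq {V : Type*} (e e' : Fin k ≃ V) (A : V → V → ℝ)
    (U : I → I → ℝ) :
    ∃ φ : Rearrangement, l1Norm (fun x y => graphFun e A x y - U (φ.1 x) (φ.1 y))
      = l1Norm (fun x y => graphFun e' A x y - U x y) := by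
  -- `ρ` sends the position of a node under `e` to its position under `e'`.
  let ρ : Equiv.Perm (Fin k) := e.trans e'.symm
  let φ := blockRearrangement ρ
  refine ⟨φ, ?_⟩
  have hmp : MeasurePreserving (fun p : I × I => (φ.1 p.1, φ.1 p.2)) volume volume :=
    (φ.2.1.prod φ.2.1)
  have hemb : MeasurableEmbedding (fun p : I × I => (φ.1 p.1, φ.1 p.2)) :=
    (φ.1.prodCongr φ.1).measurableEmbedding
  unfold l1Norm
  rw [← hmp.integral_comp hemb fun p => |graphFun e' A p.1 p.2 - U p.1 p.2|]
  have h1 : ∀ᵐ x : I, x ≠ 1 := by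
    rw [ae_iff]; simp
  have hf : ∀ᵐ p : I × I, p.1 ≠ 1 := Measure.quasiMeasurePreserving_fst.ae h1
  have hs : ∀ᵐ p : I × I, p.2 ≠ 1 := Measure.quasiMeasurePreserving_snd.ae h1
  refine integral_congr_ae ?_
  filter_upwards [hf, hs] with p hp1 hp2
  have hb : ∀ x : I, x ≠ 1 → e' (blockIdx k (φ.1 x)) = e (blockIdx k x) := by
    intro x hx
    change e' (blockIdx k (blockShift ρ x)) = _
    rw [blockIdx_blockShift ρ hx]
    simp [ρ]
  simp only [graphFun_apply, hb _ hp1, hb _ hp2]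

end Blocks
/-! ### Discretization -/

/-- Makes the integral a polynomial in the masses of the classes, so that convergence of masses
gives convergence of integrals. -/
theorem integral_prod_comp_fintype {α κ : Type*} [MeasurableSpace α] (μ ν : Measure α)
    [IsFiniteMeasure μ] [IsFiniteMeasure ν] [Fintype κ] [MeasurableSpace κ]
    [MeasurableSingletonClass κ] {T : α → κ} (hT : Measurable T) (F : κ → κ → ℝ) :
    ∫ z, F (T z.1) (T z.2) ∂(μ.prod ν)
      = ∑ p, ∑ p', μ.real (T ⁻¹' {p}) * ν.real (T ⁻¹' {p'}) * F p p' := by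
  have h1 : ∫ z, F (T z.1) (T z.2) ∂(μ.prod ν)
      = ∫ w, F w.1 w.2 ∂((μ.map T).prod (ν.map T)) := by
    rw [Measure.map_prod_map _ _ hT hT,
      integral_map (hT.prodMap hT).aemeasurable (measurable_of_finite _).aestronglyMeasurable]
    rfl
  rw [h1, integral_fintype Integrable.of_finite, Fintype.sum_prod_type]
  refine Finset.sum_congr rfl fun p _ => Finset.sum_congr rfl fun p' _ => ?_
  rw [← Set.singleton_prod_singleton, measureReal_prod_prod,
    map_measureReal_apply hT (measurableSet_singleton _),
    map_measureReal_apply hT (measurableSet_singleton _), smul_eq_mul]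

theorem integrable_comp_fintype {α κ : Type*} [MeasurableSpace α] (μ : Measure (α × α))
    [IsFiniteMeasure μ] [Finite κ] [MeasurableSpace κ] [MeasurableSingletonClass κ]
    {T : α → κ} (hT : Measurable T) (F : κ → κ → ℝ) :
    Integrable (fun z => F (T z.1) (T z.2)) μ :=
  (Integrable.of_finite (μ := μ.map (Prod.map T T))
    (f := Function.uncurry F)).comp_measurable (hT.prodMap hT)

section WellDistributed
variable {Ω : Type*} [MetricSpace Ω] [MeasurableSpace Ω] {π : Measure Ω} {S : ℕ → Finset Ω}

theorem WellDistributed.exists_partition (h : WellDistributed π S) {ε : ℝ} (hε : 0 < ε) :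
    ∃ (m : ℕ) (q : Ω → Fin m), Measurable q ∧ (∀ x y, q x = q y → dist x y ≤ ε) ∧
      ∀ j, Tendsto (fun n => (((S n).filter fun s => q s = j).card : ℝ) / (S n).card) atTop
        (𝓝 (π.real (q ⁻¹' {j}))) := by
  obtain ⟨m, Q, hQm, hQd, hQu, hdiam, hwd⟩ := h.2 ε hε
  have hex : ∀ x, ∃ j, x ∈ Q j := fun x => by
    have : x ∈ ⋃ j, Q j := by rw [hQu]; trivial
    exact Set.mem_iUnion.1 this
  choose q hq using hex
  have hpre : ∀ j x, q x = j ↔ x ∈ Q j := by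
    intro j x
    refine ⟨fun h => h ▸ hq x, fun h => ?_⟩
    by_contra hne
    exact Set.disjoint_left.1 (hQd hne) (hq x) h
  have hpre' : ∀ j, q ⁻¹' {j} = Q j := fun j => Set.ext fun x => hpre j x
  refine ⟨m, q, measurable_to_countable' fun j => ?_, fun x y hxy => ?_, fun j => ?_⟩
  · rw [hpre']; exact hQm j
  · exact hdiam (q y) x ((hpre _ _).1 hxy) y (hq y)
  · rw [hpre']
    refine (hwd j).congr fun n => ?_
    congr 2
    rw [← Set.ncard_coe_finset]
    congr 1
    ext x
    simp [hpre]

/-- One point from each class of a partition of mesh `ε` is a finite `ε`-net. -/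
theorem WellDistributed.secondCountableTopology (h : WellDistributed π S) :
    SecondCountableTopology Ω := by
  refine Metric.secondCountable_of_almost_dense_set fun ε hε => ?_
  obtain ⟨m, q, -, hq, -⟩ := h.exists_partition hε
  rcases isEmpty_or_nonempty Ω with hΩ | hΩ
  · exact ⟨∅, Set.countable_empty, fun x => hΩ.elim x⟩
  · refine ⟨Set.range (Function.invFun q), Set.countable_range _, fun x =>
      ⟨Function.invFun q (q x), ⟨_, rfl⟩, hq _ _ ?_⟩⟩
    exact (Function.invFun_eq (f := q) ⟨x, rfl⟩).symm

/-- A function that is almost everywhere continuous is, up to a small error in `L¹`, constant on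
the products of the classes of a sufficiently fine partition; the error is bounded by a function
which is itself constant on these products. -/
theorem exists_oscillation_lt [IsProbabilityMeasure π] {W : Ω → Ω → ℝ}
    (hW : IsGraphon W) (hcont : ∀ᵐ p ∂(π.prod π), ContinuousAt (Function.uncurry W) p)
    (hS : WellDistributed π S) {ε : ℝ} (hε : 0 < ε) :
    ∃ (m : ℕ) (q : Ω → Fin m) (a o : Fin m → Fin m → ℝ), Measurable q ∧
      (∀ j, Tendsto (fun n => (((S n).filter fun s => q s = j).card : ℝ) / (S n).card) atTop
        (𝓝 (π.real (q ⁻¹' {j})))) ∧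
      (∀ x y, |W x y - a (q x) (q y)| ≤ o (q x) (q y)) ∧
      ∫ z, o (q z.1) (q z.2) ∂(π.prod π) < ε := by
  have : Nonempty Ω := nonempty_of_isProbabilityMeasure π
  choose m q hqm hqd hql using fun N : ℕ =>
    hS.exists_partition (ε := 1 / ((N : ℝ) + 1)) (by positivity)
  let a : ∀ N, Fin (m N) → Fin (m N) → ℝ := fun N j j' =>
    W (Function.invFun (q N) j) (Function.invFun (q N) j')
  -- A supremum over all pairs, not an essential one, because it has to bound the error at the
  -- nodes.
  let o : ∀ N, Fin (m N) → Fin (m N) → ℝ := fun N j j' =>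
    ⨆ p : {p : Ω × Ω // q N p.1 = j ∧ q N p.2 = j'}, |W p.1.1 p.1.2 - a N j j'|
  have hdiff : ∀ x y x' y', |W x y - W x' y'| ≤ 1 := fun x y x' y' => by
    have h1 := hW.nonneg x y
    have h2 := hW.nonneg x' y'
    have h3 := hW.le_one x y
    have h4 := hW.le_one x' y'
    rw [abs_le]; constructor <;> linarith
  have ho0 : ∀ N j j', 0 ≤ o N j j' := fun N j j' => Real.iSup_nonneg fun _ => abs_nonneg _
  have ho1 : ∀ N j j', o N j j' ≤ 1 := fun N j j' =>
    Real.iSup_le (fun p => hdiff _ _ _ _) zero_le_one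
  have hWo : ∀ N x y, |W x y - a N (q N x) (q N y)| ≤ o N (q N x) (q N y) := by
    intro N x y
    refine le_ciSup (f := fun p : {p : Ω × Ω // q N p.1 = q N x ∧ q N p.2 = q N y} =>
      |W p.1.1 p.1.2 - a N (q N x) (q N y)|) ⟨1, ?_⟩ ⟨(x, y), rfl, rfl⟩
    rintro _ ⟨p, rfl⟩
    exact hdiff _ _ _ _
  have hlim : Tendsto (fun N => ∫ z, o N (q N z.1) (q N z.2) ∂(π.prod π)) atTop
      (𝓝 (∫ _, (0 : ℝ) ∂(π.prod π))) := by
    refine tendsto_integral_of_dominated_convergence (fun _ => 1) (fun N => ?_)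
      (integrable_const _) (fun N => ae_of_all _ fun z => ?_) ?_
    · have h1 : Measurable (Function.uncurry (o N)) := measurable_of_finite _
      exact (h1.comp ((hqm N).prodMap (hqm N))).aestronglyMeasurable
    · rw [Real.norm_eq_abs, abs_of_nonneg (ho0 _ _ _)]
      exact ho1 _ _ _
    -- At a continuity point the pair of classes of `z` shrinks into a ball where `W` varies by less
    -- than `η / 4`; comparing with the representatives doubles this.
    · filter_upwards [hcont] with z hz
      rw [Metric.tendsto_atTop]
      intro η hη
      obtain ⟨δ, hδ, hz'⟩ := Metric.continuousAt_iff.1 hz (η / 4) (by linarith)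
      obtain ⟨N0, hN0⟩ := exists_nat_one_div_lt hδ
      refine ⟨N0, fun N hN => ?_⟩
      have hNδ : 1 / ((N : ℝ) + 1) < δ := by
        refine lt_of_le_of_lt ?_ hN0
        apply one_div_le_one_div_of_le (by positivity)
        have : (N0 : ℝ) ≤ N := by exact_mod_cast hN
        linarith
      have hnear : ∀ x y, q N x = q N z.1 → q N y = q N z.2 → |W x y - W z.1 z.2| < η / 4 := by
        intro x y hx hy
        have := hz' (x := (x, y)) (by
          rw [Prod.dist_eq]
          exact max_lt ((hqd N _ _ hx).trans_lt hNδ) ((hqd N _ _ hy).trans_lt hNδ))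
        rwa [Real.dist_eq] at this
      rw [Real.dist_eq, sub_zero, abs_of_nonneg (ho0 _ _ _)]
      refine lt_of_le_of_lt (b := η / 2) (Real.iSup_le (fun p => ?_) (by linarith)) (by linarith)
      have h1 := hnear p.1.1 p.1.2 p.2.1 p.2.2
      have h2 := hnear _ _ (Function.invFun_eq (f := q N) ⟨z.1, rfl⟩)
        (Function.invFun_eq (f := q N) ⟨z.2, rfl⟩)
      calc |W p.1.1 p.1.2 - a N (q N z.1) (q N z.2)|
          ≤ |W p.1.1 p.1.2 - W z.1 z.2| + |W z.1 z.2 - a N (q N z.1) (q N z.2)| :=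
            abs_sub_le _ _ _
        _ ≤ η / 4 + η / 4 := by
            rw [abs_sub_comm (W z.1 z.2)]
            exact add_le_add h1.le h2.le
        _ = η / 2 := by ring
  rw [integral_zero] at hlim
  obtain ⟨N, hN⟩ := (hlim.eventually (gt_mem_nhds hε)).exists
  exact ⟨m N, q N, a N, o N, hqm N, hql N, hWo N, hN⟩

end WellDistributed

theorem IsGraphon.integrable {Ω : Type*} [MeasurableSpace Ω] {W : Ω → Ω → ℝ} (hW : IsGraphon W)
    (μ : Measure (Ω × Ω)) [IsFiniteMeasure μ] : Integrable (fun p => W p.1 p.2) μ :=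
  Integrable.of_bound (C := 1) hW.measurable.aestronglyMeasurable <| ae_of_all _ fun p => by
    rw [Real.norm_eq_abs, abs_of_nonneg (hW.nonneg _ _)]
    exact hW.le_one _ _

/-- A graphon on `[0,1]` is close in `L¹` to a function that is constant on the products of the
classes of any partition of `[0,1]` that is close to a partition into equal intervals. -/
theorem IsGraphon.exists_step_approx {V : I → I → ℝ} (hV : IsGraphon V) {ε : ℝ} (hε : 0 < ε) :
    ∃ (L : ℕ) (_ : 0 < L) (v : Fin L → Fin L → ℝ), ∀ d : I → Fin L, Measurable d →
      (∀ x : I, |(x : ℝ) - (d x : ℕ) / L| ≤ 2 / L) →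
      ∫ z : I × I, |V z.1 z.2 - v (d z.1) (d z.2)| ≤ ε := by
  obtain ⟨g, hg, hgi⟩ := (hV.integrable
    (volume : Measure (I × I))).exists_boundedContinuous_integral_sub_le (half_pos hε)
  obtain ⟨η, hη, hgη⟩ := Metric.uniformContinuous_iff.1
    (CompactSpace.uniformContinuous_of_continuous g.continuous) (ε / 2) (half_pos hε)
  -- The tolerance `2 / L` lets the same `v` serve the exact intervals and the approximate ones made
  -- of whole blocks.
  obtain ⟨L', hL'⟩ := exists_nat_gt (2 / η)
  let L := L' + 1
  have hL0 : (0 : ℝ) < L := by positivity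
  have hLη : 2 / (L : ℝ) < η := by
    rw [div_lt_iff₀ hL0]
    rw [div_lt_iff₀ hη] at hL'
    have : (L : ℝ) = L' + 1 := by simp [L]
    rw [this]; nlinarith
  let pt : Fin L → I := fun i => ⟨(i : ℕ) / L, by positivity, by
    rw [div_le_one hL0]; exact_mod_cast i.2.le⟩
  refine ⟨L, Nat.succ_pos _, fun i j => g (pt i, pt j), fun d hd hdist => ?_⟩
  have hclose : ∀ x, dist x (pt (d x)) < η := fun x => by
    rw [Subtype.dist_eq, Real.dist_eq]
    exact (hdist x).trans_lt hLη
  have hmeas : Measurable fun z : I × I => g (pt (d z.1), pt (d z.2)) := by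
    have h1 : Measurable fun p : Fin L × Fin L => g (pt p.1, pt p.2) := measurable_of_finite _
    exact h1.comp (hd.prodMap hd)
  have hbd : ∀ z : I × I, |g z - g (pt (d z.1), pt (d z.2))| ≤ ε / 2 := fun z => by
    have := hgη (a := z) (b := (pt (d z.1), pt (d z.2)))
      (by rw [Prod.dist_eq]; exact max_lt (hclose _) (hclose _))
    rw [Real.dist_eq] at this
    exact this.le
  have hi1 : Integrable (fun z : I × I => |V z.1 z.2 - g z|) :=
    ((hV.integrable _).sub hgi).abs
  have hi2 : Integrable (fun z : I × I => |g z - g (pt (d z.1), pt (d z.2))|) :=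
    Integrable.of_bound (C := ε / 2) (g.continuous.measurable.sub hmeas).abs.aestronglyMeasurable <|
      ae_of_all _ fun z => by rw [Real.norm_eq_abs, abs_abs]; exact hbd z
  calc ∫ z : I × I, |V z.1 z.2 - g (pt (d z.1), pt (d z.2))|
      ≤ ∫ z : I × I, (|V z.1 z.2 - g z| + |g z - g (pt (d z.1), pt (d z.2))|) := by
        refine integral_mono_of_nonneg (ae_of_all _ fun _ => abs_nonneg _) (hi1.add hi2)
          (ae_of_all _ fun z => abs_sub_le _ _ _)
    _ = (∫ z : I × I, |V z.1 z.2 - g z|) + ∫ z : I × I, |g z - g (pt (d z.1), pt (d z.2))| :=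
        integral_add hi1 hi2
    _ ≤ ε / 2 + ∫ _ : I × I, ε / 2 := add_le_add hg (integral_mono hi2 (integrable_const _) hbd)
    _ = ε := by simp

/-! ### Labellings with prescribed statistics -/

/-- Two finite sets of the same size, divided into classes by `f` and by `g`, can be matched in
such a way that at least `n j d` pairs consist of a member of the class `j` and one of the class
`d`, provided that the classes are large enough. -/
theorem exists_equiv_le_card {α β J D : Type*} [Fintype α] [Fintype β] [Fintype J] [Fintype D]
    [DecidableEq J] [DecidableEq D] (f : α → J) (g : β → D)
    (hcard : Fintype.card β = Fintype.card α) (n : J → D → ℕ)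
    (hr : ∀ j, ∑ d, n j d ≤ (Finset.univ.filter fun a => f a = j).card)
    (hc : ∀ d, ∑ j, n j d ≤ (Finset.univ.filter fun b => g b = d).card) :
    ∃ e : β ≃ α, ∀ j d, n j d ≤ (Finset.univ.filter fun b => f (e b) = j ∧ g b = d).card := by
  classical
  have hu : ∀ j, Nonempty ((Σ d, Fin (n j d)) ↪ {a // f a = j}) := fun j => by
    apply Function.Embedding.nonempty_of_card_le
    rw [Fintype.card_sigma, Fintype.card_subtype]
    simpa using hr j
  have hw : ∀ d, Nonempty ((Σ j, Fin (n j d)) ↪ {b // g b = d}) := fun d => by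
    apply Function.Embedding.nonempty_of_card_le
    rw [Fintype.card_sigma, Fintype.card_subtype]
    simpa using hc d
  -- The prescribed pairs are indexed by `t`; `u` and `w` give them distinct members in the required
  -- classes. The partial matching `w t ↦ u t` then extends to a bijection.
  let u : (Σ j, Σ d, Fin (n j d)) → α := fun t => ((hu t.1).some t.2 : α)
  let w : (Σ j, Σ d, Fin (n j d)) → β := fun t => ((hw t.2.1).some ⟨t.1, t.2.2⟩ : β)
  have hfu : ∀ t, f (u t) = t.1 := fun t => ((hu t.1).some t.2).2
  have hgw : ∀ t, g (w t) = t.2.1 := fun t => ((hw t.2.1).some ⟨t.1, t.2.2⟩).2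
  have hui : Function.Injective u := by
    rintro ⟨j, t⟩ ⟨j', t'⟩ h
    obtain rfl : j = j' := by
      have h1 := hfu ⟨j, t⟩
      rw [h, hfu] at h1
      exact h1.symm
    have : t = t' := (hu j).some.injective (Subtype.ext h)
    rw [this]
  have hwi : Function.Injective w := by
    rintro ⟨j, d, i⟩ ⟨j', d', i'⟩ h
    obtain rfl : d = d' := by
      have h1 := hgw ⟨j, d, i⟩
      rw [h, hgw] at h1
      exact h1.symm
    have : (⟨j, i⟩ : Σ j, Fin (n j d)) = ⟨j', i'⟩ := (hw d).some.injective (Subtype.ext h)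
    cases this
    rfl
  let e₀ : β ≃ α := Fintype.equivOfCardEq hcard
  obtain ⟨ρ, hρ⟩ := Equiv.Perm.exists_extending_pair (fun t => e₀ (w t)) u
    (e₀.injective.comp hwi) hui
  refine ⟨e₀.trans ρ, fun j d => ?_⟩
  have himg : (Finset.univ.image fun i : Fin (n j d) => w ⟨j, d, i⟩).card = n j d := by
    rw [Finset.card_image_of_injective, Finset.card_univ, Fintype.card_fin]
    intro i i' h
    have := hwi h
    simpa using this
  rw [← himg]
  refine Finset.card_le_card fun b hb => ?_
  obtain ⟨i, -, rfl⟩ := Finset.mem_image.1 hb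
  refine Finset.mem_filter.2 ⟨Finset.mem_univ _, ?_, hgw _⟩
  rw [Equiv.trans_apply, hρ]
  exact hfu _

/-- The class of `i` when `k` consecutive items are divided into `L` consecutive classes of about
the same size. -/
def coarseIdx (k L : ℕ) [NeZero L] (i : Fin k) : Fin L :=
  ⟨i * L / k, by
    rw [Nat.div_lt_iff_lt_mul i.pos, mul_comm L]
    exact Nat.mul_lt_mul_of_pos_right i.2 (NeZero.pos L)⟩

theorem coarseIdx_eq_iff {k L : ℕ} [NeZero L] (i : Fin k) (d : Fin L) :
    coarseIdx k L i = d ↔ (d : ℝ) * k / L ≤ (i : ℕ) ∧ ((i : ℕ) : ℝ) < (d + 1) * k / L := by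
  have hL : (0 : ℝ) < L := by exact_mod_cast NeZero.pos L
  rw [div_le_iff₀ hL, lt_div_iff₀ hL, coarseIdx, Fin.ext_iff]
  change (i : ℕ) * L / k = d ↔ _
  rw [Nat.div_eq_iff i.pos, Nat.le_sub_one_iff_lt (by have := i.pos; positivity)]
  norm_cast
  rw [add_mul, one_mul]

/-- A class consists of the integers in a half-open interval of length `k / L`. -/
theorem le_card_coarseIdx (k L : ℕ) [NeZero L] (d : Fin L) :
    (k : ℝ) / L - 1 ≤ (Finset.univ.filter fun i => coarseIdx k L i = d).card := by
  have hL : (0 : ℝ) < L := by exact_mod_cast NeZero.pos L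
  have hsub : Finset.Ico ⌈(d : ℝ) * k / L⌉₊ ⌈((d : ℝ) + 1) * k / L⌉₊ ⊆
      (Finset.univ.filter fun i => coarseIdx k L i = d).map Fin.valEmbedding := by
    intro i hi
    rw [Finset.mem_Ico, Nat.ceil_le, Nat.lt_ceil] at hi
    have hik : i < k := by
      have hd : (d : ℝ) + 1 ≤ L := by exact_mod_cast d.2
      have h : ((d : ℝ) + 1) * k / L ≤ k := by
        rw [div_le_iff₀ hL, mul_comm]
        exact mul_le_mul_of_nonneg_left hd (Nat.cast_nonneg _)
      exact_mod_cast hi.2.trans_le h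
    refine Finset.mem_map.2 ⟨⟨i, hik⟩, Finset.mem_filter.2 ⟨Finset.mem_univ _, ?_⟩, rfl⟩
    exact (coarseIdx_eq_iff _ _).2 hi
  have hcard := Finset.card_le_card hsub
  rw [Finset.card_map, Nat.card_Ico] at hcard
  have h1 : (⌈((d : ℝ) + 1) * k / L⌉₊ : ℝ) ≤
      (Finset.univ.filter fun i => coarseIdx k L i = d).card + ⌈(d : ℝ) * k / L⌉₊ := by
    exact_mod_cast Nat.sub_le_iff_le_add.1 hcard
  have h2 := Nat.le_ceil (((d : ℝ) + 1) * k / L)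
  have h3 := Nat.ceil_lt_add_one (a := (d : ℝ) * k / L) (by positivity)
  have h4 : ((d : ℝ) + 1) * k / L = (d : ℝ) * k / L + k / L := by ring
  linarith

/-- Two vectors with the same sum, one of which is nowhere much smaller than the other, are
close. -/
theorem abs_sub_le_of_sum_eq {κ : Type*} [Fintype κ] {f g : κ → ℝ} {η : ℝ} (hη : 0 ≤ η)
    (hsum : ∑ p, f p = ∑ p, g p) (hle : ∀ p, g p - η ≤ f p) (p : κ) :
    |f p - g p| ≤ Fintype.card κ * η := by
  have h1 : f p - g p + η ≤ ∑ p, (f p - g p + η) :=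
    Finset.single_le_sum (f := fun p => f p - g p + η) (fun p _ => by linarith [hle p])
      (Finset.mem_univ p)
  rw [Finset.sum_add_distrib, Finset.sum_sub_distrib, hsum, sub_self, zero_add, Finset.sum_const,
    Finset.card_univ, nsmul_eq_mul] at h1
  have hc : (1 : ℝ) ≤ Fintype.card κ := by
    exact_mod_cast Fintype.card_pos_iff.2 ⟨p⟩
  have h2 : η ≤ Fintype.card κ * η := le_mul_of_one_le_left hη hc
  rw [abs_le]
  constructor <;> linarith [hle p]

section Labelling
variable {Ω : Type*} [MeasurableSpace Ω] {π : Measure Ω} {S : ℕ → Finset Ω}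

/-- The cell masses of `μ` have the class masses and `1 / L` as marginals. Requesting only the
fraction `1 - θ` of each cell leaves room for sampling error in the classes and rounding in the
intervals. Only lower bounds are arranged; upper bounds follow since frequencies and masses both sum
to `1`. -/
theorem eventually_exists_labelling [IsProbabilityMeasure π] {m L : ℕ} [NeZero L]
    {q : Ω → Fin m} (hq : Measurable q) (hcard : Tendsto (fun n => (S n).card) atTop atTop)
    (hlim : ∀ j, Tendsto (fun n => (((S n).filter fun s => q s = j).card : ℝ) / (S n).card) atTop
        (𝓝 (π.real (q ⁻¹' {j}))))
    {μ : Measure (Ω × I)} (hfst : MeasurePreserving Prod.fst μ π)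
    (hsnd : MeasurePreserving Prod.snd μ volume) {δ : ℝ} (hδ : 0 < δ) :
    ∀ᶠ n in atTop, ∃ e : Fin (S n).card ≃ S n, ∀ p : Fin m × Fin L,
      |((Finset.univ.filter fun i => (q (e i), coarseIdx (S n).card L i) = p).card : ℝ)
        / (S n).card - μ.real ((fun z => (q z.1, blockIdx L z.2)) ⁻¹' {p})| ≤ δ := by
  have hμ : IsProbabilityMeasure μ := by
    refine ⟨?_⟩
    rw [← Set.preimage_univ (f := Prod.fst), hfst.measure_preimage MeasurableSet.univ.nullMeasurableSet,
      measure_univ]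
  have hL : (0 : ℝ) < L := by exact_mod_cast NeZero.pos L
  let T : Ω × I → Fin m × Fin L := fun z => (q z.1, blockIdx L z.2)
  have hT : Measurable T := (hq.comp measurable_fst).prodMk (measurable_blockIdx.comp measurable_snd)
  let c : Fin m × Fin L → ℝ := fun p => μ.real (T ⁻¹' {p})
  have hc0 : ∀ p, 0 ≤ c p := fun p => measureReal_nonneg
  have hcsum : ∑ p, c p = 1 := by
    have := sum_measureReal_preimage_singleton (μ := μ) (Finset.univ : Finset (Fin m × Fin L))
      (f := T) (fun p _ => hT (measurableSet_singleton p))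
    simpa using this
  have hrow : ∀ j, ∑ d, c (j, d) = π.real (q ⁻¹' {j}) := by
    intro j
    have h := sum_measureReal_preimage_singleton (μ := μ)
      (Finset.univ.map ⟨fun d : Fin L => (j, d), fun d d' h => (Prod.ext_iff.1 h).2⟩)
      (f := T) (fun p _ => hT (measurableSet_singleton p))
    rw [Finset.sum_map] at h
    refine Eq.trans h ?_
    rw [← hfst.measureReal_preimage (hq (measurableSet_singleton j)).nullMeasurableSet]
    congr 1
    ext z
    simp only [T, Finset.coe_map, Finset.coe_univ, Set.image_univ, Set.mem_preimage,
      Set.mem_range, Set.mem_singleton_iff]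
    exact ⟨fun ⟨y, hy⟩ => (congrArg Prod.fst hy).symm, fun h => ⟨_, Prod.ext h.symm rfl⟩⟩
  have hcol : ∀ d, ∑ j, c (j, d) = 1 / L := by
    intro d
    have h := sum_measureReal_preimage_singleton (μ := μ)
      (Finset.univ.map ⟨fun j : Fin m => (j, d), fun d d' h => (Prod.ext_iff.1 h).1⟩)
      (f := T) (fun p _ => hT (measurableSet_singleton p))
    rw [Finset.sum_map] at h
    refine Eq.trans h ?_
    rw [← volume_real_blockIdx_preimage d, ← hsnd.measureReal_preimage
      (measurable_blockIdx (measurableSet_singleton d)).nullMeasurableSet]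
    congr 1
    ext z
    simp only [T, Finset.coe_map, Finset.coe_univ, Set.image_univ, Set.mem_preimage,
      Set.mem_range, Set.mem_singleton_iff]
    exact ⟨fun ⟨y, hy⟩ => (congrArg Prod.snd hy).symm, fun h => ⟨_, Prod.ext rfl h.symm⟩⟩
  set N : ℝ := (Fintype.card (Fin m × Fin L) : ℝ) with hN
  have hN0 : 0 ≤ N := Nat.cast_nonneg _
  -- Each cell falls short by at most `2 * θ`, half from the factor `1 - θ` and half from the floor;
  -- summing over `N` cells must stay below `δ`.
  let θ : ℝ := min (1 / 2) (δ / (2 * (N + 1)))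
  have hθ0 : 0 < θ := lt_min (by norm_num) (by positivity)
  have hθ1 : θ ≤ 1 / 2 := min_le_left _ _
  have hθN : N * (2 * θ) ≤ δ := by
    have h1 : θ ≤ δ / (2 * (N + 1)) := min_le_right _ _
    rw [le_div_iff₀ (by positivity)] at h1
    nlinarith
  have hcardR : Tendsto (fun n => ((S n).card : ℝ)) atTop atTop :=
    tendsto_natCast_atTop_atTop.comp hcard
  have hev : ∀ᶠ n in atTop, ∀ j, (S n).card * ((1 - θ) * π.real (q ⁻¹' {j})) ≤
      ((S n).filter fun s => q s = j).card := by
    rw [eventually_all]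
    intro j
    -- A null class requests nothing; otherwise the inequality is strict in the limit.
    rcases (measureReal_nonneg (μ := π) (s := q ⁻¹' {j})).eq_or_lt with h0 | h0
    · refine Eventually.of_forall fun n => ?_
      rw [← h0]; simp
    · have hlt : (1 - θ) * π.real (q ⁻¹' {j}) < π.real (q ⁻¹' {j}) := by nlinarith
      filter_upwards [(hlim j).eventually (lt_mem_nhds hlt), hcardR.eventually_gt_atTop 0]
        with n hn hk
      rw [lt_div_iff₀ hk] at hn
      linarith
  filter_upwards [hev, hcardR.eventually_ge_atTop (L / θ), hcardR.eventually_ge_atTop (1 / θ),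
    hcardR.eventually_gt_atTop 0] with n hn hkL hkθ hk0
  set k := (S n).card with hk
  let t : Fin m → Fin L → ℕ := fun j d => ⌊k * ((1 - θ) * c (j, d))⌋₊
  have ht : ∀ j d, (t j d : ℝ) ≤ k * ((1 - θ) * c (j, d)) := fun j d =>
    Nat.floor_le (mul_nonneg hk0.le (mul_nonneg (by linarith) (hc0 _)))
  have ht' : ∀ j d, k * ((1 - θ) * c (j, d)) - 1 ≤ (t j d : ℝ) := fun j d =>
    (Nat.sub_one_lt_floor _).le
  obtain ⟨e, he⟩ := exists_equiv_le_card (fun s : S n => q s) (coarseIdx k L) (by simp [hk]) t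
    (fun j => by
      have h1 : ((∑ d, t j d : ℕ) : ℝ) ≤ ((S n).filter fun s => q s = j).card := by
        push_cast
        refine (Finset.sum_le_sum fun d _ => ht j d).trans ?_
        rw [← Finset.mul_sum, ← Finset.mul_sum, hrow]
        exact hn j
      have h2 : (Finset.univ.filter fun s : S n => q s = j).card
          = ((S n).filter fun s => q s = j).card := by
        rw [← Finset.card_map (Function.Embedding.subtype _)]
        congr 1
        ext x
        simp [and_comm]
      rw [h2]
      exact_mod_cast h1)
    (fun d => by
      have h1 : ((∑ j, t j d : ℕ) : ℝ) ≤
          (Finset.univ.filter fun i => coarseIdx k L i = d).card := by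
        push_cast
        refine (Finset.sum_le_sum fun j _ => ht j d).trans ?_
        rw [← Finset.mul_sum, ← Finset.mul_sum, hcol]
        refine le_trans ?_ (le_card_coarseIdx k L d)
        have h3 : 1 ≤ (k : ℝ) / L * θ := by
          rw [div_le_iff₀ hθ0] at hkL
          rw [div_mul_eq_mul_div, le_div_iff₀ hL]
          linarith
        have h4 : (k : ℝ) * ((1 - θ) * (1 / L)) = k / L - k / L * θ := by ring
        linarith
      exact_mod_cast h1)
  refine ⟨e, fun p => ?_⟩
  refine (abs_sub_le_of_sum_eq (η := 2 * θ)
    (f := fun p => ((Finset.univ.filter fun i => (q (e i), coarseIdx k L i) = p).card : ℝ) / k)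
    (g := c) (by linarith) ?_ ?_ p).trans hθN
  · rw [hcsum, ← Finset.sum_div, div_eq_one_iff_eq hk0.ne']
    have := Finset.card_eq_sum_card_fiberwise (s := (Finset.univ : Finset (Fin k)))
      (f := fun i => (q (e i), coarseIdx k L i)) (t := Finset.univ) (fun _ _ => Finset.mem_univ _)
    rw [Finset.card_univ, Fintype.card_fin] at this
    exact_mod_cast this.symm
  · rintro ⟨j, d⟩
    have h1 := he j d
    have h2 : (t j d : ℝ) ≤
        (Finset.univ.filter fun i => (q (e i), coarseIdx k L i) = (j, d)).card := by
      simp only [Prod.mk.injEq]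
      exact_mod_cast h1
    have h3 := ht' j d
    have hc1 : c (j, d) ≤ 1 := measureReal_le_one
    have hk1 : 1 ≤ k * θ := by rwa [div_le_iff₀ hθ0] at hkθ
    rw [le_div_iff₀ hk0]
    have h5 : (k : ℝ) * θ * c (j, d) ≤ k * θ * 1 :=
      mul_le_mul_of_nonneg_left hc1 (by positivity)
    nlinarith

end Labelling

/-! ### The cut norm of a step function -/

/-- A linear form on a box is largest at the vertex that keeps the positive coefficients. -/
theorem exists_sum_mul_le {ι : Type*} [Fintype ι] {c : ℝ} {w : ι → ℝ} (hw0 : ∀ i, 0 ≤ w i)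
    (hwc : ∀ i, w i ≤ c) (f : ι → ℝ) : ∃ A : Finset ι, ∑ i, w i * f i ≤ c * ∑ i ∈ A, f i := by
  classical
  refine ⟨Finset.univ.filter fun i => 0 < f i, ?_⟩
  rw [Finset.mul_sum, Finset.sum_filter]
  refine Finset.sum_le_sum fun i _ => ?_
  split_ifs with h
  · exact mul_le_mul_of_nonneg_right (hwc i) h.le
  · exact mul_nonpos_of_nonneg_of_nonpos (hw0 i) (not_lt.1 h)

/-- The form is linear in each weight vector separately, so each in turn is replaced by a vertex. -/
theorem sum_mul_mul_le {ι : Type*} [Fintype ι] {c C : ℝ} {w w' : ι → ℝ} (hc : 0 ≤ c)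
    (hw0 : ∀ i, 0 ≤ w i) (hwc : ∀ i, w i ≤ c) (hw0' : ∀ i, 0 ≤ w' i) (hwc' : ∀ i, w' i ≤ c)
    (B : ι → ι → ℝ) (hB : ∀ A A' : Finset ι, ∑ i ∈ A, ∑ j ∈ A', B i j ≤ C) :
    ∑ i, ∑ j, w i * w' j * B i j ≤ c * (c * C) := by
  obtain ⟨A, hA⟩ := exists_sum_mul_le hw0 hwc fun i => ∑ j, w' j * B i j
  obtain ⟨A', hA'⟩ := exists_sum_mul_le hw0' hwc' fun j => ∑ i ∈ A, B i j
  calc ∑ i, ∑ j, w i * w' j * B i j = ∑ i, w i * ∑ j, w' j * B i j := by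
        simp only [Finset.mul_sum, mul_assoc]
    _ ≤ c * ∑ i ∈ A, ∑ j, w' j * B i j := hA
    _ = c * ∑ j, w' j * ∑ i ∈ A, B i j := by
        rw [Finset.sum_comm]; simp only [Finset.mul_sum]
    _ ≤ c * (c * ∑ j ∈ A', ∑ i ∈ A, B i j) := mul_le_mul_of_nonneg_left hA' hc
    _ ≤ c * (c * C) := by
        rw [Finset.sum_comm]
        exact mul_le_mul_of_nonneg_left (mul_le_mul_of_nonneg_left (hB _ _) hc) hc

theorem cutNorm_le {U : I → I → ℝ} {C : ℝ}
    (h : ∀ s t : Set I, MeasurableSet s → MeasurableSet t → |∫ z in s ×ˢ t, U z.1 z.2| ≤ C) :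
    cutNorm U ≤ C := by
  have : Nonempty ({S : Set I // MeasurableSet S} × {T : Set I // MeasurableSet T}) :=
    ⟨⟨∅, MeasurableSet.empty⟩, ⟨∅, MeasurableSet.empty⟩⟩
  exact ciSup_le fun p => h _ _ p.1.2 p.2.2

/-- `s` and `t` meet each block in measure at most `1 / k`, so the bilinear bound applies with `c =
1 / k`. -/
theorem abs_setIntegral_graphFun_le {V : Type*} {k : ℕ} [NeZero k] (e : Fin k ≃ V)
    (B : V → V → ℝ) {C : ℝ} (hB : ∀ A A' : Finset V, |∑ i ∈ A, ∑ j ∈ A', B i j| ≤ C * (k : ℝ) ^ 2)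
    (s t : Set I) : |∫ z in s ×ˢ t, graphFun e B z.1 z.2| ≤ C := by
  have hk : (0 : ℝ) < k := by exact_mod_cast NeZero.pos k
  have hk1 : (0 : ℝ) ≤ 1 / k := by positivity
  have hwc : ∀ (s : Set I) (i : Fin k), ((volume : Measure I).restrict s).real (blockIdx k ⁻¹' {i})
      ≤ 1 / k := by
    intro s i
    rw [← volume_real_blockIdx_preimage i]
    exact ENNReal.toReal_mono (measure_ne_top _ _) (Measure.restrict_apply_le _ _)
  have hint : ∫ z in s ×ˢ t, graphFun e B z.1 z.2
      = ∑ i : Fin k, ∑ j : Fin k, ((volume : Measure I).restrict s).real (blockIdx k ⁻¹' {i}) *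
        ((volume : Measure I).restrict t).real (blockIdx k ⁻¹' {j}) * B (e i) (e j) := by
    rw [← integral_prod_comp_fintype _ _ measurable_blockIdx fun i j => B (e i) (e j),
      Measure.prod_restrict]
    simp only [graphFun_apply]
    rfl
  have hC : (1 / k : ℝ) * (1 / k * (C * (k : ℝ) ^ 2)) = C := by field_simp
  have hmap : ∀ (f : V → V → ℝ) (A A' : Finset (Fin k)), ∑ i ∈ A, ∑ j ∈ A', f (e i) (e j)
      = ∑ i ∈ A.map e.toEmbedding, ∑ j ∈ A'.map e.toEmbedding, f i j := by
    intro f A A'; simp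
  rw [hint, abs_le']
  constructor
  · refine (sum_mul_mul_le hk1 (fun _ => measureReal_nonneg) (hwc s) (fun _ => measureReal_nonneg)
      (hwc t) (fun i j => B (e i) (e j)) (C := C * (k : ℝ) ^ 2) fun A A' => ?_).trans hC.le
    rw [hmap B]
    exact (abs_le'.1 (hB _ _)).1
  · have h := (sum_mul_mul_le hk1 (fun _ => measureReal_nonneg) (hwc s)
      (fun _ => measureReal_nonneg) (hwc t) (fun i j => -B (e i) (e j)) (C := C * (k : ℝ) ^ 2)
      fun A A' => ?_).trans hC.le
    · simpa only [mul_neg, Finset.sum_neg_distrib] using h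
    · rw [hmap fun i j => -B i j]
      simpa only [Finset.sum_neg_distrib] using (abs_le'.1 (hB _ _)).2

theorem integrable_graphFun {V : Type*} {k : ℕ} [NeZero k] (e : Fin k ≃ V) (A : V → V → ℝ) :
    Integrable (fun z : I × I => graphFun e A z.1 z.2) := by
  simp only [graphFun_apply]
  exact integrable_comp_fintype _ measurable_blockIdx fun i j => A (e i) (e j)

/-- The cut norm of the difference between a step function and a function `U` is bounded by the
`L¹` distance of `U` from another step function together with the discrete cut norm of the
difference of the weights. -/
theorem cutNorm_graphFun_sub_le {V : Type*} {k : ℕ} [NeZero k] (e : Fin k ≃ V)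
    (A A' : V → V → ℝ) {C : ℝ}
    (hA : ∀ B B' : Finset V, |∑ i ∈ B, ∑ j ∈ B', (A i j - A' i j)| ≤ C * (k : ℝ) ^ 2)
    {U : I → I → ℝ} (hU : Integrable fun z : I × I => U z.1 z.2) :
    cutNorm (fun x y => graphFun e A x y - U x y)
      ≤ C + l1Norm fun x y => graphFun e A' x y - U x y := by
  refine cutNorm_le fun s t _ _ => ?_
  have hi : Integrable fun z : I × I => graphFun e A' z.1 z.2 - U z.1 z.2 :=
    (integrable_graphFun e A').sub hU
  have hsplit : ∫ z in s ×ˢ t, (graphFun e A z.1 z.2 - U z.1 z.2)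
      = (∫ z in s ×ˢ t, graphFun e (fun i j => A i j - A' i j) z.1 z.2)
        + ∫ z in s ×ˢ t, (graphFun e A' z.1 z.2 - U z.1 z.2) := by
    rw [← integral_add (integrable_graphFun e _).integrableOn hi.integrableOn]
    refine integral_congr_ae (ae_of_all _ fun z => ?_)
    simp only [graphFun_apply]
    ring
  rw [hsplit]
  refine (abs_add_le _ _).trans (add_le_add (abs_setIntegral_graphFun_le e _ hA s t) ?_)
  refine (abs_integral_le_integral_abs).trans ?_
  exact setIntegral_le_integral hi.abs (ae_of_all _ fun _ => abs_nonneg _)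

/-! ### Concentration -/

theorem _root_.ProbabilityTheory.HasSubgaussianMGF.mono {X : Type*} [MeasurableSpace X]
    {P : Measure X} {Y : X → ℝ} {c c' : NNReal} (h : HasSubgaussianMGF Y c P) (hc : c ≤ c') :
    HasSubgaussianMGF Y c' P where
  integrable_exp_mul := h.integrable_exp_mul
  mgf_le t := (h.mgf_le t).trans <| Real.exp_le_exp.2 <| by
    have : (c : ℝ) ≤ c' := hc
    gcongr

section RandomGraph
variable {Ω X : Type*} [MeasurableSpace X] {P : Measure X} [IsProbabilityMeasure P]
  {S : Finset Ω} {W : Ω → Ω → ℝ} {G : X → SimpleGraph S}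

open Classical in
/-- The difference between the number of edges and the expected number of edges between two sets
of nodes is sub-Gaussian. -/
theorem IsWRandomGraph.hasSubgaussianMGF (h : IsWRandomGraph P S W G) (hW0 : ∀ s t, 0 ≤ W s t)
    (A A' : Finset S) :
    HasSubgaussianMGF
      (fun x => ∑ i ∈ A, ∑ j ∈ A', (adjWeight (G x) i j - weightedGraph S W i j))
      ((S.card : NNReal) ^ 2) P := by
  let E : Sym2 S → Set X := fun ed => {x | ed ∈ (G x).edgeSet}
  have hE : ∀ ed, MeasurableSet (E ed) := by
    intro ed
    induction ed with
    | _ a b => exact h.measurableSet_adj a b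
  -- An unordered pair occurs at most twice in `A ×ˢ A'`, once per order; grouping by it yields
  -- independent summands.
  let mult : Sym2 S → ℕ := fun ed => ((A ×ˢ A').filter fun p => s(p.1, p.2) = ed).card
  have hmult : ∀ ed, mult ed ≤ 2 := by
    intro ed
    induction ed with
    | _ a b =>
      refine (Finset.card_le_card (t := {(a, b), (b, a)}) fun p hp => ?_).trans Finset.card_le_two
      have := (Finset.mem_filter.1 hp).2
      rw [Sym2.eq_iff] at this
      rw [Finset.mem_insert, Finset.mem_singleton]
      exact this.imp (fun h => Prod.ext h.1 h.2) fun h => Prod.ext h.1 h.2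
  let g : Sym2 S → X → ℝ := fun ed x => (E ed).indicator (fun _ => (1 : ℝ)) x - P.real (E ed)
  have hg : ∀ (i j : S) (x : X), adjWeight (G x) i j - weightedGraph S W i j = g s(i, j) x := by
    intro i j x
    have hEij : E s(i, j) = {x | (G x).Adj i j} := rfl
    have h1 : adjWeight (G x) i j = (E s(i, j)).indicator (fun _ => (1 : ℝ)) x := by
      rw [hEij, Set.indicator_apply]; rfl
    have h2 : weightedGraph S W i j = P.real (E s(i, j)) := by
      rw [hEij, weightedGraph]
      split_ifs with hij
      · subst hij; simp
      · rw [measureReal_def, h.prob_adj i j hij, ENNReal.toReal_ofReal (hW0 _ _)]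
    rw [h1, h2]
  have hgdiag : ∀ ed : Sym2 S, ed.IsDiag → ∀ x, g ed x = 0 := by
    intro ed hed x
    have : E ed = ∅ := by
      ext x
      simp only [E, Set.mem_ofPred_eq, Set.mem_empty_iff_false, iff_false]
      exact fun hx => (G x).not_isDiag_of_mem_edgeSet hx hed
    simp [g, this]
  have hsum : ∀ x, ∑ i ∈ A, ∑ j ∈ A', (adjWeight (G x) i j - weightedGraph S W i j)
      = ∑ ed : {ed : Sym2 S // ¬ ed.IsDiag}, (mult ed : ℝ) * g ed x := by
    intro x
    calc ∑ i ∈ A, ∑ j ∈ A', (adjWeight (G x) i j - weightedGraph S W i j)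
        = ∑ p ∈ A ×ˢ A', g s(p.1, p.2) x := by
          rw [Finset.sum_product]; simp only [hg]
      _ = ∑ ed : Sym2 S, ∑ p ∈ (A ×ˢ A').filter (fun p => s(p.1, p.2) = ed), g ed x :=
          (Finset.sum_fiberwise' _ (fun p : S × S => s(p.1, p.2)) fun ed => g ed x).symm
      _ = ∑ ed : Sym2 S, (mult ed : ℝ) * g ed x := by
          simp only [Finset.sum_const, nsmul_eq_mul, mult]
      _ = ∑ ed ∈ Finset.univ.filter (fun ed : Sym2 S => ¬ ed.IsDiag), (mult ed : ℝ) * g ed x := by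
          symm
          apply Finset.sum_filter_of_ne
          intro ed _ hne hd
          exact hne (by rw [hgdiag ed hd, mul_zero])
      _ = _ := Finset.sum_subtype _ (by simp) _
  simp only [hsum]
  have hsub : ∀ ed : {ed : Sym2 S // ¬ ed.IsDiag},
      HasSubgaussianMGF (fun x => (mult ed : ℝ) * g ed x) 1 P := by
    intro ed
    have hm : Measurable ((E ed).indicator fun _ => (1 : ℝ)) := measurable_const.indicator (hE _)
    have h1 := hasSubgaussianMGF_of_mem_Icc (μ := P) (X := (E ed).indicator fun _ => (1 : ℝ))
      (a := 0) (b := 1) hm.aemeasurable (ae_of_all _ fun x => by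
        by_cases hx : x ∈ E ed <;> simp [hx])
    have hmean : P[(E ed).indicator fun _ => (1 : ℝ)] = P.real (E ed) := by
      rw [integral_indicator_const _ (hE _), smul_eq_mul, mul_one]
    rw [hmean] at h1
    refine (h1.const_mul (mult ed : ℝ)).mono ?_
    rw [← NNReal.coe_le_coe]
    -- A variable in `[0,1]` has parameter `1 / 4`, and the multiplicity contributes at most `2 ^
    -- 2`.
    change (mult ed : ℝ) ^ 2 * (((‖(1 : ℝ) - 0‖₊ / 2) ^ 2 : NNReal) : ℝ) ≤ 1
    have : ((mult ed : ℕ) : ℝ) ≤ 2 := by exact_mod_cast hmult ed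
    have h0 : (0 : ℝ) ≤ (mult ed : ℕ) := Nat.cast_nonneg _
    have h2 : (((‖(1 : ℝ) - 0‖₊ / 2) ^ 2 : NNReal) : ℝ) = 1 / 4 := by norm_num
    rw [h2]
    nlinarith
  have hind : iIndepFun (fun (ed : {ed : Sym2 S // ¬ ed.IsDiag}) x => (mult ed : ℝ) * g ed x) P :=
    (h.indep.iIndepFun_indicator (β := ℝ)).comp
      (fun ed y => (mult ed : ℝ) * (y - P.real (E ed))) fun ed => by fun_prop
  refine (HasSubgaussianMGF.sum_of_iIndepFun hind fun ed _ => hsub ed).mono ?_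
  rw [Finset.sum_const, Finset.card_univ, nsmul_eq_mul, mul_one]
  have hc : Fintype.card {ed : Sym2 S // ¬ ed.IsDiag} ≤ S.card ^ 2 := by
    refine (Fintype.card_subtype_le _).trans ?_
    have := Fintype.card_le_of_surjective (fun p : S × S => s(p.1, p.2))
      (fun ed => by induction ed with | _ a b => exact ⟨(a, b), rfl⟩)
    rw [Fintype.card_prod, Fintype.card_coe] at this
    rwa [sq]
  exact_mod_cast hc

theorem IsWRandomGraph.measure_exists_le (h : IsWRandomGraph P S W G) (hW0 : ∀ s t, 0 ≤ W s t)
    {t : ℝ} (ht : 0 < t) :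
    P {x | ∃ p : Finset S × Finset S, t * (S.card : ℝ) ^ 2 ≤
        |∑ i ∈ p.1, ∑ j ∈ p.2, (adjWeight (G x) i j - weightedGraph S W i j)|}
      ≤ ENNReal.ofReal (2 * Real.exp (4 / t ^ 2) *
          Real.exp (-(t ^ 2 / 4) * (S.card : ℝ) ^ 2)) := by
  classical
  set k : ℝ := (S.card : ℝ) with hk
  have hk0 : 0 ≤ k := Nat.cast_nonneg _
  have hone : ∀ (Y : X → ℝ), HasSubgaussianMGF Y ((S.card : NNReal) ^ 2) P →
      P {x | t * k ^ 2 ≤ Y x} ≤ ENNReal.ofReal (Real.exp (-(t ^ 2 / 2) * k ^ 2)) := by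
    intro Y hY
    have h1 := hY.measure_ge_le (ε := t * k ^ 2) (by positivity)
    rw [← ofReal_measureReal]
    refine ENNReal.ofReal_le_ofReal (h1.trans (le_of_eq ?_))
    congr 1
    push_cast
    rw [← hk]
    rcases hk0.eq_or_lt with h0 | h0
    · rw [← h0]; simp
    · field_simp
  have hset : {x | ∃ p : Finset S × Finset S, t * k ^ 2 ≤
        |∑ i ∈ p.1, ∑ j ∈ p.2, (adjWeight (G x) i j - weightedGraph S W i j)|}
      = ⋃ p : Finset S × Finset S, {x | t * k ^ 2 ≤
        |∑ i ∈ p.1, ∑ j ∈ p.2, (adjWeight (G x) i j - weightedGraph S W i j)|} := by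
    ext x; simp
  have htwo : ∀ p : Finset S × Finset S, P {x | t * k ^ 2 ≤
        |∑ i ∈ p.1, ∑ j ∈ p.2, (adjWeight (G x) i j - weightedGraph S W i j)|}
      ≤ ENNReal.ofReal (2 * Real.exp (-(t ^ 2 / 2) * k ^ 2)) := by
    intro p
    have hY := h.hasSubgaussianMGF hW0 p.1 p.2
    rw [two_mul, ENNReal.ofReal_add (Real.exp_pos _).le (Real.exp_pos _).le]
    refine le_trans ?_ (add_le_add (hone _ hY) (hone _ hY.neg))
    refine le_trans (measure_mono fun x hx => ?_) (measure_union_le _ _)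
    rw [Set.mem_ofPred_eq] at hx
    exact (le_abs.1 hx).imp id id
  rw [hset]
  refine (measure_iUnion_fintype_le _ _).trans ((Finset.sum_le_sum fun p _ => htwo p).trans ?_)
  rw [Finset.sum_const, Finset.card_univ, nsmul_eq_mul, Fintype.card_prod, Fintype.card_finset,
    Fintype.card_coe, ← ENNReal.ofReal_natCast, ← ENNReal.ofReal_mul (Nat.cast_nonneg _)]
  apply ENNReal.ofReal_le_ofReal
  have h4 : (((2 ^ S.card * 2 ^ S.card : ℕ)) : ℝ) ≤ Real.exp (2 * k) := by
    have h2 : (2 : ℝ) ≤ Real.exp 1 := by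
      have := Real.add_one_le_exp (1 : ℝ); linarith
    have h3 : (2 : ℝ) ^ S.card ≤ Real.exp k := by
      rw [hk, ← mul_one (S.card : ℝ), Real.exp_nat_mul]
      exact pow_le_pow_left₀ (by norm_num) h2 _
    push_cast
    rw [two_mul, Real.exp_add]
    exact mul_le_mul h3 h3 (by positivity) (Real.exp_pos _).le
  calc _ ≤ Real.exp (2 * k) * (2 * Real.exp (-(t ^ 2 / 2) * k ^ 2)) :=
        mul_le_mul_of_nonneg_right h4 (by positivity)
    _ = 2 * Real.exp (2 * k + -(t ^ 2 / 2) * k ^ 2) := by rw [Real.exp_add]; ring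
    _ ≤ 2 * Real.exp (4 / t ^ 2 + -(t ^ 2 / 4) * k ^ 2) := by
        refine mul_le_mul_of_nonneg_left (Real.exp_le_exp.2 ?_) (by norm_num)
        -- Half of the Gaussian exponent absorbs the `2 * k` of the union bound, up to a constant
        -- independent of `k`.
        have h5 : 0 ≤ (t * k / 2 - 2 / t) ^ 2 := sq_nonneg _
        have h6 : (t * k / 2 - 2 / t) ^ 2 = t ^ 2 / 4 * k ^ 2 - 2 * k + 4 / t ^ 2 := by
          field_simp
          ring
        linarith
    _ = _ := by rw [Real.exp_add]; ring

end RandomGraph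

/-! ### Convergence of the weighted graphs -/

theorem volume_real_preimage_comp_blockIdx {k : ℕ} [NeZero k] {κ : Type*} [DecidableEq κ]
    (f : Fin k → κ) (p : κ) :
    (volume : Measure I).real ((fun x => f (blockIdx k x)) ⁻¹' {p})
      = ((Finset.univ.filter fun i => f i = p).card : ℝ) / k := by
  have h := sum_measureReal_preimage_singleton (μ := (volume : Measure I))
    (Finset.univ.filter fun i => f i = p) (f := blockIdx k)
    (fun i _ => measurable_blockIdx (measurableSet_singleton i))
  simp only [volume_real_blockIdx_preimage, Finset.sum_const, nsmul_eq_mul, mul_one_div] at h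
  rw [h]
  congr 1
  ext x
  simp

/-- One `1 / L` is the length of the coarse interval; the other bounds the width `1 / k` of a block
that may stick out of it. -/
theorem abs_sub_coarseIdx_le {k L : ℕ} [NeZero k] [NeZero L] (hLk : L ≤ k) (x : I) :
    |(x : ℝ) - (coarseIdx k L (blockIdx k x) : ℕ) / L| ≤ 2 / L := by
  have hL : (0 : ℝ) < L := by exact_mod_cast NeZero.pos L
  have hk : (0 : ℝ) < k := by exact_mod_cast NeZero.pos k
  have hLk' : (L : ℝ) ≤ k := by exact_mod_cast hLk
  obtain ⟨h1, h2⟩ := (coarseIdx_eq_iff (blockIdx k x) (coarseIdx k L (blockIdx k x))).1 rfl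
  have h3 := blockIdx_le (k := k) x
  have h4 := le_blockIdx_add_one (k := k) x
  set d : ℝ := ((coarseIdx k L (blockIdx k x) : ℕ) : ℝ)
  set b : ℝ := ((blockIdx k x : ℕ) : ℝ)
  rw [div_le_iff₀ hL] at h1
  rw [lt_div_iff₀ hL] at h2
  have e : (x : ℝ) - d / L = (x * L - d) / L := by field_simp
  rw [e, abs_div, abs_of_pos hL]
  refine div_le_div_of_nonneg_right ?_ hL.le
  have h5 : 0 ≤ (k : ℝ) * (x * L - d) := by nlinarith
  have h6 : (k : ℝ) * (x * L - d) ≤ k * 2 := by nlinarith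
  have h7 : 0 ≤ (x : ℝ) * L - d := by
    by_contra h
    nlinarith
  rw [abs_of_nonneg h7]
  exact le_of_mul_le_mul_left h6 hk

theorem abs_sub_blockIdx_le {L : ℕ} [NeZero L] (x : I) :
    |(x : ℝ) - (blockIdx L x : ℕ) / L| ≤ 2 / L := by
  have hL : (0 : ℝ) < L := by exact_mod_cast NeZero.pos L
  have h3 := blockIdx_le (k := L) x
  have h4 := le_blockIdx_add_one (k := L) x
  have e : (x : ℝ) - (blockIdx L x : ℕ) / L = (L * x - (blockIdx L x : ℕ)) / L := by field_simp
  rw [e, abs_div, abs_of_pos hL]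
  refine div_le_div_of_nonneg_right ?_ hL.le
  rw [abs_of_nonneg (by linarith)]
  linarith

section Main
variable {Ω : Type*} [MetricSpace Ω] [MeasurableSpace Ω] {π : Measure Ω} [IsProbabilityMeasure π]
  {W : Ω → Ω → ℝ} {S : ℕ → Finset Ω}

/-- The error passes through `a` and `v`: it costs `ε` for oscillation, `ε` for the missing loops,
`3 * ε` for `a` against `v`, and `ε` for `v` against `V`. -/
theorem eventually_exists_l1Norm_lt (hW : IsGraphon W)
    (hcont : ∀ᵐ p ∂(π.prod π), ContinuousAt (Function.uncurry W) p)
    (hS : WellDistributed π S) {V : I → I → ℝ} (hV : IsGraphon V) (hR : Represents π W V)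
    {ε : ℝ} (hε : 0 < ε) :
    ∀ᶠ n in atTop, ∃ e : Fin (S n).card ≃ S n,
      l1Norm (fun x y => graphFun e (weightedGraph (S n) W) x y - V x y) < 6 * ε := by
  classical
  obtain ⟨μ, hfst, hsnd, hμ⟩ := hR
  have : IsProbabilityMeasure μ := by
    refine ⟨?_⟩
    rw [← Set.preimage_univ (f := Prod.fst),
      hfst.measure_preimage MeasurableSet.univ.nullMeasurableSet, measure_univ]
  obtain ⟨m, q, a, o, hq, hlim, hWo, hoε⟩ := exists_oscillation_lt hW hcont hS hε
  obtain ⟨L, hL, v, hv⟩ := hV.exists_step_approx hε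
  have : NeZero L := ⟨hL.ne'⟩
  let T : Ω × I → Fin m × Fin L := fun z => (q z.1, blockIdx L z.2)
  have hT : Measurable T :=
    (hq.comp measurable_fst).prodMk (measurable_blockIdx.comp measurable_snd)
  let F : Fin m × Fin L → Fin m × Fin L → ℝ := fun p p' => |a p.1 p'.1 - v p.2 p'.2|
  -- The mean of `|a - v|` as a function of the cell masses; `c` are the masses under the coupling.
  let Φ : (Fin m × Fin L → ℝ) → ℝ := fun w => ∑ p, ∑ p', w p * w p' * F p p'
  let c : Fin m × Fin L → ℝ := fun p => μ.real (T ⁻¹' {p})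
  have hoint : ∫ z, o (q z.1.1) (q z.2.1) ∂(μ.prod μ) < ε := by
    have h := (hfst.prod hfst).map_eq
    rw [← h, integral_map (hfst.prod hfst).aemeasurable
      (integrable_comp_fintype _ hq o).aestronglyMeasurable] at hoε
    exact hoε
  have hvint : ∫ z, |V z.1.2 z.2.2 - v (blockIdx L z.1.2) (blockIdx L z.2.2)| ∂(μ.prod μ) ≤ ε := by
    have h1 := hv (blockIdx L) measurable_blockIdx abs_sub_blockIdx_le
    have h := (hsnd.prod hsnd).map_eq
    have hi : Integrable (fun z : I × I => |V z.1 z.2 - v (blockIdx L z.1) (blockIdx L z.2)|)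
        (volume.prod volume) :=
      ((hV.integrable _).sub (integrable_comp_fintype _ measurable_blockIdx v)).abs
    rw [← h] at hi
    rw [Measure.volume_eq_prod, ← h, integral_map (hsnd.prod hsnd).aemeasurable
      hi.aestronglyMeasurable] at h1
    exact h1
  have hΦc : Φ c < 3 * ε := by
    have h1 : Φ c = ∫ z, F (T z.1) (T z.2) ∂(μ.prod μ) := (integral_prod_comp_fintype μ μ hT F).symm
    have hi1 : Integrable (fun z : (Ω × I) × (Ω × I) => o (q z.1.1) (q z.2.1)) (μ.prod μ) :=
      integrable_comp_fintype _ (hq.comp measurable_fst) o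
    have hi2 : Integrable (fun z : (Ω × I) × (Ω × I) =>
        |V z.1.2 z.2.2 - v (blockIdx L z.1.2) (blockIdx L z.2.2)|) (μ.prod μ) := by
      refine Integrable.abs (Integrable.sub ?_
        (integrable_comp_fintype _ (measurable_blockIdx.comp measurable_snd) v))
      exact (hsnd.prod hsnd).integrable_comp_of_integrable (hV.integrable _)
    have h2 : ∫ z, F (T z.1) (T z.2) ∂(μ.prod μ) ≤ ∫ z, (o (q z.1.1) (q z.2.1)
        + |V z.1.2 z.2.2 - v (blockIdx L z.1.2) (blockIdx L z.2.2)|) ∂(μ.prod μ) := by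
      refine integral_mono_of_nonneg (ae_of_all _ fun _ => abs_nonneg _) (hi1.add hi2) ?_
      -- Here the coupling enters: `W` and `V` agree, so `a` and `v` are compared through their
      -- common value.
      filter_upwards [hμ] with z hz
      have h3 := hWo z.1.1 z.2.1
      rw [hz, abs_sub_comm] at h3
      exact (abs_sub_le _ (V z.1.2 z.2.2) _).trans (add_le_add h3 le_rfl)
    rw [integral_add hi1 hi2] at h2
    linarith
  have hΦcont : Continuous Φ := by fun_prop
  obtain ⟨δ, hδ, hΦδ⟩ := Metric.eventually_nhds_iff.1 (hΦcont.continuousAt.eventually (gt_mem_nhds hΦc))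
  have hosum : ∀ᶠ n in atTop, ∑ j, ∑ j',
      (((S n).filter fun s => q s = j).card : ℝ) / (S n).card *
      ((((S n).filter fun s => q s = j').card : ℝ) / (S n).card) * o j j' < ε := by
    rw [integral_prod_comp_fintype π π hq o] at hoε
    refine Tendsto.eventually ?_ (gt_mem_nhds hoε)
    exact tendsto_finsetSum _ fun j _ => tendsto_finsetSum _ fun j' _ =>
      ((hlim j).mul (hlim j')).mul_const _
  have hcardR : Tendsto (fun n => ((S n).card : ℝ)) atTop atTop :=
    tendsto_natCast_atTop_atTop.comp hS.1
  filter_upwards [eventually_exists_labelling (L := L) hq hS.1 hlim hfst hsnd (half_pos hδ), hosum,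
    hS.1.eventually_ge_atTop L, hcardR.eventually_gt_atTop (1 / ε)] with n hlab hon hLk hkε
  obtain ⟨e, he⟩ := hlab
  let k := (S n).card
  have hk0 : 0 < k := hL.trans_le hLk
  have : NeZero k := ⟨hk0.ne'⟩
  have hkR : (0 : ℝ) < k := by exact_mod_cast hk0
  refine ⟨e, ?_⟩
  let b : I → Fin k := blockIdx k
  let T₁ : I → Fin m := fun x => q (e (b x))
  let T₂ : I → Fin m × Fin L := fun x => (q (e (b x)), coarseIdx k L (b x))
  let d : I → Fin L := fun x => coarseIdx k L (b x)
  have hb : Measurable b := measurable_blockIdx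
  have hT₁ : Measurable T₁ := (measurable_of_finite fun i => q (e i)).comp hb
  have hT₂ : Measurable T₂ :=
    (measurable_of_finite fun i => (q (e i), coarseIdx k L i)).comp hb
  have hd : Measurable d := (measurable_of_finite fun i => coarseIdx k L i).comp hb
  have hi1 : Integrable fun z : I × I => o (T₁ z.1) (T₁ z.2) := integrable_comp_fintype _ hT₁ o
  have hi2 : Integrable fun z : I × I => if b z.1 = b z.2 then (1 : ℝ) else 0 :=
    integrable_comp_fintype _ hb fun i j => if i = j then (1 : ℝ) else 0
  have hi3 : Integrable fun z : I × I => F (T₂ z.1) (T₂ z.2) := integrable_comp_fintype _ hT₂ F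
  have hi4 : Integrable fun z : I × I => |V z.1 z.2 - v (d z.1) (d z.2)| :=
    ((hV.integrable _).sub (integrable_comp_fintype _ hd v)).abs
  have hi12 : Integrable fun z : I × I =>
      o (T₁ z.1) (T₁ z.2) + (if b z.1 = b z.2 then (1 : ℝ) else 0) := hi1.add hi2
  have hi123 : Integrable fun z : I × I =>
      o (T₁ z.1) (T₁ z.2) + (if b z.1 = b z.2 then (1 : ℝ) else 0) + F (T₂ z.1) (T₂ z.2) :=
    hi12.add hi3
  have hI1 : ∫ z : I × I, o (T₁ z.1) (T₁ z.2) < ε := by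
    rw [Measure.volume_eq_prod, integral_prod_comp_fintype volume volume hT₁ o]
    have h1 : ∀ j, (volume : Measure I).real (T₁ ⁻¹' {j})
        = (((S n).filter fun s => q s = j).card : ℝ) / k := by
      intro j
      rw [volume_real_preimage_comp_blockIdx (fun i => q (e i)) j]
      congr 2
      refine Finset.card_bij (fun i _ => (e i : Ω)) (fun i hi => ?_) (fun i _ i' _ h => ?_)
        (fun s hs => ?_)
      · exact Finset.mem_filter.2 ⟨(e i).2, (Finset.mem_filter.1 hi).2⟩
      · exact e.injective (Subtype.ext h)
      · obtain ⟨hs, hqs⟩ := Finset.mem_filter.1 hs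
        refine ⟨e.symm ⟨s, hs⟩, Finset.mem_filter.2 ⟨Finset.mem_univ _, ?_⟩, ?_⟩ <;> simp [hqs]
    simp only [h1]
    exact hon
  have hI2 : ∫ z : I × I, (if b z.1 = b z.2 then (1 : ℝ) else 0) < ε := by
    rw [Measure.volume_eq_prod,
      integral_prod_comp_fintype volume volume hb fun i j => if i = j then (1 : ℝ) else 0]
    have h1 : (∑ i : Fin k, ∑ j : Fin k, (volume : Measure I).real (b ⁻¹' {i}) *
        (volume : Measure I).real (b ⁻¹' {j}) * (if i = j then (1 : ℝ) else 0)) = 1 / k := by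
      simp only [b, volume_real_blockIdx_preimage, mul_ite, mul_one, mul_zero, Finset.sum_ite_eq,
        Finset.mem_univ, if_true, Finset.sum_const, Finset.card_univ, Fintype.card_fin,
        nsmul_eq_mul]
      field_simp
    rw [h1]
    exact (one_div_lt hkR hε).2 hkε
  have hI3 : ∫ z : I × I, F (T₂ z.1) (T₂ z.2) < 3 * ε := by
    rw [Measure.volume_eq_prod, integral_prod_comp_fintype volume volume hT₂ F]
    refine hΦδ (y := fun p => (volume : Measure I).real (T₂ ⁻¹' {p})) ?_
    refine lt_of_le_of_lt ((dist_pi_le_iff (half_pos hδ).le).2 fun p => ?_) (half_lt_self hδ)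
    rw [Real.dist_eq,
      volume_real_preimage_comp_blockIdx (fun i => (q (e i), coarseIdx k L i)) p]
    exact he p
  have hI4 : ∫ z : I × I, |V z.1 z.2 - v (d z.1) (d z.2)| ≤ ε :=
    hv d hd fun x => abs_sub_coarseIdx_le hLk x
  have hpt : ∀ z : I × I, |graphFun e (weightedGraph (S n) W) z.1 z.2 - V z.1 z.2|
      ≤ o (T₁ z.1) (T₁ z.2) + (if b z.1 = b z.2 then (1 : ℝ) else 0) + F (T₂ z.1) (T₂ z.2)
        + |V z.1 z.2 - v (d z.1) (d z.2)| := by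
    intro z
    rw [graphFun_apply]
    have h1 : |weightedGraph (S n) W (e (b z.1)) (e (b z.2)) - a (T₁ z.1) (T₁ z.2)|
        ≤ o (T₁ z.1) (T₁ z.2) + (if b z.1 = b z.2 then (1 : ℝ) else 0) := by
      have h2 := hWo (e (b z.1)) (e (b z.2))
      have h3 := hW.nonneg (e (b z.1)) (e (b z.2))
      have h4 := hW.le_one (e (b z.1)) (e (b z.2))
      -- On diagonal blocks the weight is `0` instead of a value of `W`, an error of at most `1` on
      -- total area `1 / k`.
      by_cases hz : b z.1 = b z.2
      · rw [if_pos hz, weightedGraph, if_pos (by rw [hz])]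
        rw [abs_le] at h2 ⊢
        constructor <;> linarith
      · rw [if_neg hz, weightedGraph, if_neg fun h => hz (e.injective h), add_zero]
        exact h2
    have h5 := abs_sub_le (weightedGraph (S n) W (e (b z.1)) (e (b z.2)))
      (a (T₁ z.1) (T₁ z.2)) (V z.1 z.2)
    have h6 := abs_sub_le (a (T₁ z.1) (T₁ z.2)) (v (d z.1) (d z.2)) (V z.1 z.2)
    rw [abs_sub_comm (v _ _)] at h6
    have h7 : F (T₂ z.1) (T₂ z.2) = |a (T₁ z.1) (T₁ z.2) - v (d z.1) (d z.2)| := rfl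
    rw [h7]
    linarith
  calc l1Norm (fun x y => graphFun e (weightedGraph (S n) W) x y - V x y)
      ≤ ∫ z : I × I, (o (T₁ z.1) (T₁ z.2) + (if b z.1 = b z.2 then (1 : ℝ) else 0)
        + F (T₂ z.1) (T₂ z.2) + |V z.1 z.2 - v (d z.1) (d z.2)|) :=
        integral_mono_of_nonneg (ae_of_all _ fun _ => abs_nonneg _)
          (hi123.add hi4) (ae_of_all _ hpt)
    _ = (∫ z : I × I, o (T₁ z.1) (T₁ z.2)) + (∫ z : I × I, if b z.1 = b z.2 then (1 : ℝ) else 0)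
        + (∫ z : I × I, F (T₂ z.1) (T₂ z.2)) + ∫ z : I × I, |V z.1 z.2 - v (d z.1) (d z.2)| := by
        rw [integral_add hi123 hi4, integral_add hi12 hi3, integral_add hi1 hi2]
    _ < 6 * ε := by linarith

theorem eventually_exists_rearrangement (hW : IsGraphon W)
    (hcont : ∀ᵐ p ∂(π.prod π), ContinuousAt (Function.uncurry W) p)
    (hS : WellDistributed π S) {V : I → I → ℝ} (hV : IsGraphon V) (hR : Represents π W V)
    (e : ∀ n, Fin (S n).card ≃ S n) {ε : ℝ} (hε : 0 < ε) :
    ∀ᶠ n in atTop, ∃ φ : Rearrangement, l1Norm (fun x y =>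
      graphFun (e n) (weightedGraph (S n) W) x y - V (φ.1 x) (φ.1 y)) < ε := by
  filter_upwards [eventually_exists_l1Norm_lt hW hcont hS hV hR (ε := ε / 6) (by linarith),
    hS.1.eventually_gt_atTop 0] with n ⟨e', he'⟩ hn
  have : NeZero (S n).card := ⟨hn.ne'⟩
  obtain ⟨φ, hφ⟩ := exists_rearrangement_l1Norm_eq (e n) e' (weightedGraph (S n) W) V
  exact ⟨φ, by rw [hφ]; linarith⟩

theorem l1Norm_nonneg (U : I → I → ℝ) : 0 ≤ l1Norm U := integral_nonneg fun _ => abs_nonneg _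

theorem cutNorm_nonneg (U : I → I → ℝ) : 0 ≤ cutNorm U := Real.iSup_nonneg fun _ => abs_nonneg _

theorem editDist_nonneg (U V : I → I → ℝ) : 0 ≤ editDist U V :=
  Real.iInf_nonneg fun _ => l1Norm_nonneg _

theorem cutDist_nonneg (U V : I → I → ℝ) : 0 ≤ cutDist U V :=
  Real.iInf_nonneg fun _ => cutNorm_nonneg _

theorem editDist_le (U V : I → I → ℝ) (φ : Rearrangement) :
    editDist U V ≤ l1Norm fun x y => U x y - V (φ.1 x) (φ.1 y) :=
  ciInf_le ⟨0, by rintro _ ⟨ψ, rfl⟩; exact l1Norm_nonneg _⟩ φ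

theorem cutDist_le (U V : I → I → ℝ) (φ : Rearrangement) :
    cutDist U V ≤ cutNorm fun x y => U x y - V (φ.1 x) (φ.1 y) :=
  ciInf_le ⟨0, by rintro _ ⟨ψ, rfl⟩; exact cutNorm_nonneg _⟩ φ

theorem IsGraphon.rearrange {V : I → I → ℝ} (hV : IsGraphon V) (φ : Rearrangement) :
    IsGraphon fun x y => V (φ.1 x) (φ.1 y) where
  measurable := hV.measurable.comp (φ.1.measurable.prodMap φ.1.measurable)
  symm _ _ := hV.symm _ _
  nonneg _ _ := hV.nonneg _ _
  le_one _ _ := hV.le_one _ _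

theorem tendsto_editDist_weightedGraph (hW : IsGraphon W)
    (hcont : ∀ᵐ p ∂(π.prod π), ContinuousAt (Function.uncurry W) p)
    (hS : WellDistributed π S) {V : I → I → ℝ} (hV : IsGraphon V) (hR : Represents π W V)
    (e : ∀ n, Fin (S n).card ≃ S n) :
    Tendsto (fun n => editDist (graphFun (e n) (weightedGraph (S n) W)) V) atTop (𝓝 0) := by
  rw [tendsto_order]
  refine ⟨fun r hr => Eventually.of_forall fun n => hr.trans_le (editDist_nonneg _ _),
    fun r hr => ?_⟩
  filter_upwards [eventually_exists_rearrangement hW hcont hS hV hR e hr] with n ⟨φ, hφ⟩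
  exact (editDist_le _ _ φ).trans_lt hφ

/-! ### Almost sure convergence of the random graphs -/

/-- The random graphs almost surely have the same edge statistics, asymptotically, as the weighted
graphs from which they are sampled. -/
theorem ae_eventually_abs_sum_lt {Ω X : Type*} [MeasurableSpace X] {P : Measure X}
    [IsProbabilityMeasure P] {S : ℕ → Finset Ω} {W : Ω → Ω → ℝ} {G : ∀ n, X → SimpleGraph (S n)}
    (hG : ∀ n, IsWRandomGraph P (S n) W (G n)) (hW0 : ∀ s t, 0 ≤ W s t)
    (hsum : ∀ c : ℝ, 0 < c → Summable fun n => Real.exp (-c * ((S n).card : ℝ) ^ 2)) :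
    ∀ᵐ x ∂P, ∀ N : ℕ, ∀ᶠ n in atTop, ∀ A A' : Finset (S n),
      |∑ i ∈ A, ∑ j ∈ A', (adjWeight (G n x) i j - weightedGraph (S n) W i j)|
        ≤ 1 / ((N : ℝ) + 1) * ((S n).card : ℝ) ^ 2 := by
  rw [ae_all_iff]
  intro N
  have ht : (0 : ℝ) < 1 / ((N : ℝ) + 1) := by positivity
  set t : ℝ := 1 / ((N : ℝ) + 1)
  -- Summable failure probabilities allow the first Borel–Cantelli lemma, which needs no assumption
  -- on the joint law of the graphs.
  have hfin : ∑' n, P {x | ∃ p : Finset (S n) × Finset (S n), t * ((S n).card : ℝ) ^ 2 ≤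
      |∑ i ∈ p.1, ∑ j ∈ p.2, (adjWeight (G n x) i j - weightedGraph (S n) W i j)|} ≠ ⊤ := by
    have hs := (hsum (t ^ 2 / 4) (by positivity)).mul_left (2 * Real.exp (4 / t ^ 2))
    exact ne_top_of_le_ne_top hs.tsum_ofReal_ne_top
      (ENNReal.tsum_le_tsum fun n => (hG n).measure_exists_le hW0 ht)
  filter_upwards [ae_eventually_notMem hfin] with x hx
  filter_upwards [hx] with n hn A A'
  by_contra hlt
  exact hn ⟨(A, A'), (not_le.1 hlt).le⟩

theorem ae_adjWeight_eq {Ω X : Type*} [MeasurableSpace X] {P : Measure X} [IsProbabilityMeasure P]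
    {S : Finset Ω} {W : Ω → Ω → ℝ} {G : X → SimpleGraph S} (hG : IsWRandomGraph P S W G)
    (h01 : ∀ s t, W s t = 0 ∨ W s t = 1) :
    ∀ᵐ x ∂P, adjWeight (G x) = weightedGraph S W := by
  classical
  have h : ∀ s t : S, ∀ᵐ x ∂P, adjWeight (G x) s t = weightedGraph S W s t := by
    intro s t
    by_cases hst : s = t
    · subst hst
      exact ae_of_all _ fun x => by simp [adjWeight, weightedGraph]
    have hp := hG.prob_adj s t hst
    rcases h01 s t with h0 | h1
    · rw [h0, ENNReal.ofReal_zero] at hp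
      filter_upwards [measure_eq_zero_iff_ae_notMem.1 hp] with x hx
      have hx' : ¬ (G x).Adj s t := hx
      simp [adjWeight, weightedGraph, hst, h0, hx']
    · rw [h1, ENNReal.ofReal_one] at hp
      filter_upwards [(mem_ae_iff_prob_eq_one (hG.measurableSet_adj s t)).2 hp] with x hx
      have hx' : (G x).Adj s t := hx
      simp [adjWeight, weightedGraph, hst, h1, hx']
  filter_upwards [ae_all_iff.2 fun s => ae_all_iff.2 (h s)] with x hx
  exact funext fun s => funext fun t => hx s t

end Main

/-- The rearrangement that is good for the weighted graph is reused; the change of weights costs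
only its discrete cut norm. -/
theorem tendsto_cutDist_of_abs_sum_le {Ω : Type*} [MetricSpace Ω] [MeasurableSpace Ω]
    {π : Measure Ω} [IsProbabilityMeasure π] {W : Ω → Ω → ℝ} {S : ℕ → Finset Ω}
    (hW : IsGraphon W)
    (hcont : ∀ᵐ p ∂(π.prod π), ContinuousAt (Function.uncurry W) p)
    (hS : WellDistributed π S) {V : I → I → ℝ} (hV : IsGraphon V) (hR : Represents π W V)
    (e : ∀ n, Fin (S n).card ≃ S n) {A : ∀ n, S n → S n → ℝ}
    (hA : ∀ N : ℕ, ∀ᶠ n in atTop, ∀ B B' : Finset (S n),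
      |∑ i ∈ B, ∑ j ∈ B', (A n i j - weightedGraph (S n) W i j)|
        ≤ 1 / ((N : ℝ) + 1) * ((S n).card : ℝ) ^ 2) :
    Tendsto (fun n => cutDist (graphFun (e n) (A n)) V) atTop (𝓝 0) := by
  rw [tendsto_order]
  refine ⟨fun r hr => Eventually.of_forall fun n => hr.trans_le (cutDist_nonneg _ _),
    fun r hr => ?_⟩
  obtain ⟨N, hN⟩ := exists_nat_one_div_lt (half_pos hr)
  filter_upwards [eventually_exists_rearrangement hW hcont hS hV hR e (half_pos hr), hA N,
    hS.1.eventually_gt_atTop 0] with n ⟨φ, hφ⟩ hAn hn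
  have : NeZero (S n).card := ⟨hn.ne'⟩
  have h := cutNorm_graphFun_sub_le (e n) (A n) (weightedGraph (S n) W) hAn
    (U := fun x y => V (φ.1 x) (φ.1 y)) ((hV.rearrange φ).integrable volume)
  exact (cutDist_le _ _ φ).trans_lt (by linarith)

end GraphLimits

theorem lemma2p3 {Ω : Type*} [MetricSpace Ω] [MeasurableSpace Ω] [BorelSpace Ω]
    (π : Measure Ω) [IsProbabilityMeasure π] [NullSingletonClass π]
    (W : Ω → Ω → ℝ) (hW : GraphLimits.IsGraphon W)
    (hcont : ∀ᵐ p ∂(π.prod π), ContinuousAt (Function.uncurry W) p)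
    (S : ℕ → Finset Ω) (hS : GraphLimits.WellDistributed π S)
    (e : ∀ n, Fin (S n).card ≃ S n) :
    (∃ V : I → I → ℝ, GraphLimits.IsGraphon V ∧ GraphLimits.Represents π W V) ∧
    ∀ V : I → I → ℝ, GraphLimits.IsGraphon V → GraphLimits.Represents π W V →
      Tendsto (fun n => GraphLimits.editDist
        (GraphLimits.graphFun (e n) (GraphLimits.weightedGraph (S n) W)) V) atTop (𝓝 0) ∧
      ∀ {X : Type*} [MeasurableSpace X] (P : Measure X) [IsProbabilityMeasure P]
        (G : ∀ n, X → SimpleGraph (S n)),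
        (∀ n, GraphLimits.IsWRandomGraph P (S n) W (G n)) →
        ((∀ c : ℝ, 0 < c → Summable fun n => Real.exp (-c * ((S n).card : ℝ) ^ 2)) →
          ∀ᵐ x ∂P, Tendsto (fun n => GraphLimits.cutDist
            (GraphLimits.graphFun (e n) (GraphLimits.adjWeight (G n x))) V) atTop (𝓝 0)) ∧
        ((∀ s t, W s t = 0 ∨ W s t = 1) →
          ∀ᵐ x ∂P, Tendsto (fun n => GraphLimits.editDist
            (GraphLimits.graphFun (e n) (GraphLimits.adjWeight (G n x))) V) atTop (𝓝 0)) := by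
  have := hS.secondCountableTopology
  refine ⟨GraphLimits.exists_represents π hW, fun V hV hR => ?_⟩
  have hlim := GraphLimits.tendsto_editDist_weightedGraph hW hcont hS hV hR e
  refine ⟨hlim, fun {X} _ P _ G hG => ⟨fun hsum => ?_, fun h01 => ?_⟩⟩
  · filter_upwards [GraphLimits.ae_eventually_abs_sum_lt hG hW.nonneg hsum] with x hx
    exact GraphLimits.tendsto_cutDist_of_abs_sum_le hW hcont hS hV hR e hx
  -- One null set for each `n` is discarded, so no growth condition is needed.
  · filter_upwards [ae_all_iff.2 fun n => GraphLimits.ae_adjWeight_eq (hG n) h01] with x hx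
    simpa only [hx] using hlim
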